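/- Let $\{a(p,q) : 1\le p\le q<\infty\}$ be real random variables on a probability space, and for $n\ge 1$ let $\mathbf X_n$ be the symmetric random $n\times n$ matrix with entries $$\mathbf X_n(p,q)=\mathbf X_n(q,p)=\frac{1}{\sqrt n}\,a(p,q),\qquad 1\le p\le q\le n.$$ Assume: (C1) $\mathbb E[a(p,q)]=0$ and $\mathbb E[a(p,q)^2]=1$ for all $p\le q$, and $\sup_{1\le p\le q}\mathbb E[|a(p,q)|^k]<\infty$ for every $k\in\mathbb N$; (C2) the diagonals, that is the families $\{a(p,p+r) : p\ge 1\}$, $r=0,1,2,\dots$, are independent; (C3) the covariance of two entries on the same diagonal depends only on their distance: for every integer $\tau\ge 0$ there is a number $\mathrm{Cov}(\tau)$ such that $\mathrm{Cov}(a(p,q),a(p+\tau,q+\tau))=\mathrm{Cov}(\tau)$ for all $1\le p\le q$; (C4) $\sum_{\tau=0}^\infty|\mathrm{Cov}(\tau)|<\infty$. Let $\lambda^{(n)}_1\le\dots\le\lambda^{(n)}_n$ be the eigenvalues of $\mathbf X_n$, counted with multiplicity, let $\mu_n=\frac1n\sum_{k=1}^n\delta_{\lambda^{(n)}_k}$ be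 its empirical eigenvalue distribution, and let $\mu$ be the standard semicircle distribution, with density $\frac{1}{2\pi}\sqrt{4-x^2}$ on $[-2,2]$ and $0$ elsewhere. Then, as $n\to\infty$, $\mu_n$ converges weakly to $\mu$ both in expectation, i.e. the expected empirical eigenvalue distributions $B\mapsto\mathbb E[\mu_n(B)]$ converge weakly to $\mu$, and almost surely, i.e. with probability $1$ the sequence $(\mu_n)$ converges weakly to $\mu$. -/

import Mathlib

open MeasureTheory ProbabilityTheory Filter Topology
open scoped ENNReal

/-- The symmetric random matrix `X_n`, with `X_n(p,q) = X_n(q,p) = a(p,q) / √n` for `p ≤ q`.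
Indices start at `0` instead of `1`, and only the values `a p q` with `p ≤ q` are used. -/
noncomputable def randomMatrix {Ω : Type*} (a : ℕ → ℕ → Ω → ℝ) (n : ℕ) (ω : Ω) :
    Matrix (Fin n) (Fin n) ℝ :=
  Matrix.of fun i j =>
    if (i : ℕ) ≤ (j : ℕ) then a i j ω / √(n : ℝ) else a j i ω / √(n : ℝ)

theorem randomMatrix_isHermitian {Ω : Type*} (a : ℕ → ℕ → Ω → ℝ) (n : ℕ) (ω : Ω) :
    (randomMatrix a n ω).IsHermitian := by
  ext i j
  simp only [randomMatrix, Matrix.conjTranspose_apply, Matrix.of_apply, star_trivial]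
  rcases lt_trichotomy (i : ℕ) (j : ℕ) with h | h | h
  · rw [if_neg (not_le.mpr h), if_pos h.le]
  · rw [h]
  · rw [if_pos h.le, if_neg (not_le.mpr h)]

/-- The empirical eigenvalue distribution `μ_n = (1/n) ∑ₖ δ_{λₖ}` of `X_n`, the eigenvalues being
counted with multiplicity. It is a probability measure for `n ≥ 1`. -/
noncomputable def empiricalDistribution {Ω : Type*} (a : ℕ → ℕ → Ω → ℝ) (n : ℕ) (ω : Ω) :
    Measure ℝ :=
  (n : ℝ≥0∞)⁻¹ • ∑ k : Fin n, Measure.dirac ((randomMatrix_isHermitian a n ω).eigenvalues k)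

/-- The expected empirical eigenvalue distribution `B ↦ 𝔼[μ_n(B)]`. -/
noncomputable def meanEmpiricalDistribution {Ω : Type*} [MeasurableSpace Ω] (P : Measure Ω)
    (a : ℕ → ℕ → Ω → ℝ) (n : ℕ) : Measure ℝ :=
  P.bind (empiricalDistribution a n)

/-- The density of the standard semicircle distribution. -/
noncomputable def semicircleDensity (x : ℝ) : ℝ :=
  if -2 ≤ x ∧ x ≤ 2 then 1 / (2 * Real.pi) * √(4 - x ^ 2) else 0

theorem semicircleDensity_eq (x : ℝ) :
    semicircleDensity x = 1 / (2 * Real.pi) * √(4 - x ^ 2) := by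
  unfold semicircleDensity
  split_ifs with h
  · rfl
  · rw [Real.sqrt_eq_zero_of_nonpos, mul_zero]
    by_contra hx
    exact h ⟨by nlinarith, by nlinarith⟩

theorem integral_semicircleDensity :
    ∫ x in (-2 : ℝ)..2, semicircleDensity x = 1 := by
  have h := intervalIntegral.integral_comp_mul_left (a := (-1 : ℝ)) (b := 1)
    (fun x => √(4 - x ^ 2)) (two_ne_zero (α := ℝ))
  have h2 : ∀ x : ℝ, √(4 - (2 * x) ^ 2) = 2 * √(1 - x ^ 2) := by
    intro x
    rw [show (4 : ℝ) - (2 * x) ^ 2 = 2 ^ 2 * (1 - x ^ 2) by ring,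
      Real.sqrt_mul (by norm_num), Real.sqrt_sq (by norm_num)]
  simp only [h2, intervalIntegral.integral_const_mul, integral_sqrt_one_sub_sq] at h
  simp only [semicircleDensity_eq, intervalIntegral.integral_const_mul]
  norm_num at h
  have h3 : ∫ x in (-2 : ℝ)..2, √(4 - x ^ 2) = 2 * Real.pi := by linarith
  rw [h3]
  field_simp

theorem isProbabilityMeasure_semicircle :
    IsProbabilityMeasure
      ((volume : Measure ℝ).withDensity fun x => ENNReal.ofReal (semicircleDensity x)) := by
  constructor
  have hc : Continuous semicircleDensity := by
    rw [funext semicircleDensity_eq]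
    fun_prop
  have h0 : ∀ x, x ∉ Set.Ioc (-2 : ℝ) 2 → semicircleDensity x = 0 := by
    intro x hx
    rw [semicircleDensity_eq, Real.sqrt_eq_zero_of_nonpos, mul_zero]
    by_contra h
    exact hx ⟨by nlinarith, by nlinarith⟩
  have hnn : ∀ x, 0 ≤ semicircleDensity x := by
    intro x
    rw [semicircleDensity_eq]
    positivity
  have hi : Integrable semicircleDensity := by
    rw [← integrableOn_iff_integrable_of_support_subset (s := Set.Ioc (-2 : ℝ) 2)]
    · exact (hc.integrableOn_Icc).mono_set Set.Ioc_subset_Icc_self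
    · intro x hx
      by_contra h
      exact hx (h0 x h)
  rw [withDensity_apply _ MeasurableSet.univ, Measure.restrict_univ,
    ← ofReal_integral_eq_lintegral_ofReal hi (Filter.Eventually.of_forall hnn),
    ← setIntegral_eq_integral_of_forall_compl_eq_zero h0,
    ← intervalIntegral.integral_of_le (by norm_num), integral_semicircleDensity,
    ENNReal.ofReal_one]

/-- The standard semicircle distribution. -/
noncomputable def semicircle : ProbabilityMeasure ℝ :=
  ⟨(volume : Measure ℝ).withDensity fun x => ENNReal.ofReal (semicircleDensity x),
    isProbabilityMeasure_semicircle⟩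

/-- Weak convergence `ν_n ⇒ μ`: for `n ≥ 1` the measures `ν_n` are probability measures, and they
converge to `μ` in the topology of weak convergence of probability measures. -/
def ConvergesWeakly (ν : ℕ → Measure ℝ) (μ : ProbabilityMeasure ℝ) : Prop :=
  ∃ ν' : ℕ → ProbabilityMeasure ℝ,
    (∀ n, 1 ≤ n → (ν' n : Measure ℝ) = ν n) ∧ Tendsto ν' atTop (𝓝 μ)

/-! ### Joint moments of the entries -/

/-- The entry at position `(i, j)` of the unnormalised symmetric matrix. -/
noncomputable def entry {Ω : Type*} (a : ℕ → ℕ → Ω → ℝ) (i j : ℕ) (ω : Ω) : ℝ :=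
  a (min i j) (max i j) ω

theorem entry_comm {Ω : Type*} (a : ℕ → ℕ → Ω → ℝ) (i j : ℕ) : entry a i j = entry a j i := by
  funext ω
  simp only [entry, min_comm i j, max_comm i j]

/-- The diagonal to which the position `(i, j)` or `(j, i)` belongs. -/
def diagIndex (i j : ℕ) : ℕ := ((j : ℤ) - i).natAbs

theorem min_add_diagIndex (i j : ℕ) : min i j + diagIndex i j = max i j := by
  unfold diagIndex; omega

/-- The hypotheses on the entries: moments, independent diagonals, stationary summable
covariances along each diagonal. -/
structure IndependentDiagonals {Ω : Type*} [MeasurableSpace Ω] (P : Measure Ω)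
    (a : ℕ → ℕ → Ω → ℝ) (Cov : ℕ → ℝ) : Prop where
  meas : ∀ p q, p ≤ q → Measurable (a p q)
  mean : ∀ p q, p ≤ q → ∫ ω, a p q ω ∂P = 0
  var : ∀ p q, p ≤ q → ∫ ω, (a p q ω) ^ 2 ∂P = 1
  mom : ∀ k : ℕ, (⨆ (p : ℕ) (q : ℕ) (_ : p ≤ q), ∫⁻ ω, ‖a p q ω‖ₑ ^ k ∂P) < ∞
  indep : iIndepFun (fun (r : ℕ) (ω : Ω) (p : ℕ) => a p (p + r) ω) P
  cov : ∀ τ p q, p ≤ q → cov[a p q, a (p + τ) (q + τ); P] = Cov τ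
  summable : Summable fun τ => |Cov τ|

theorem Finset.prod_abs_le_one_add_sum_pow {ι : Type*} (s : Finset ι) (x : ι → ℝ) {K : ℕ}
    (hs : s.card ≤ K) : ∏ e ∈ s, |x e| ≤ 1 + ∑ e ∈ s, |x e| ^ K := by
  rcases s.eq_empty_or_nonempty with rfl | hne
  · simp
  obtain ⟨m, hm, hmax⟩ := s.exists_max_image (fun e => |x e|) hne
  have hsum : |x m| ^ K ≤ ∑ e ∈ s, |x e| ^ K :=
    Finset.single_le_sum (f := fun e => |x e| ^ K) (fun _ _ => by positivity) hm
  have hsum0 : 0 ≤ ∑ e ∈ s, |x e| ^ K := Finset.sum_nonneg fun e _ => by positivity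
  rcases le_total |x m| 1 with h1 | h1
  · have : ∏ e ∈ s, |x e| ≤ 1 :=
      Finset.prod_le_one (fun e _ => abs_nonneg _) fun e he => (hmax e he).trans h1
    linarith
  · calc ∏ e ∈ s, |x e| ≤ ∏ _e ∈ s, |x m| :=
          Finset.prod_le_prod (fun e _ => abs_nonneg _) fun e he => hmax e he
      _ = |x m| ^ s.card := by simp
      _ ≤ |x m| ^ K := pow_le_pow_right₀ h1 hs
      _ ≤ _ := by linarith

namespace IndependentDiagonals

variable {Ω : Type*} [MeasurableSpace Ω] {P : Measure Ω}
  {a : ℕ → ℕ → Ω → ℝ} {Cov : ℕ → ℝ}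

theorem measurable_entry (H : IndependentDiagonals P a Cov) (i j : ℕ) :
    Measurable (entry a i j) := H.meas _ _ (min_le_max)

theorem exists_moment_bound (H : IndependentDiagonals P a Cov) (k : ℕ) :
    ∃ B : ℝ, 0 ≤ B ∧ ∀ i j, Integrable (fun ω => |entry a i j ω| ^ k) P ∧
      ∫ ω, |entry a i j ω| ^ k ∂P ≤ B := by
  refine ⟨_, ENNReal.toReal_nonneg (a := ⨆ (p : ℕ) (q : ℕ) (_ : p ≤ q),
    ∫⁻ ω, ‖a p q ω‖ₑ ^ k ∂P), fun i j => ?_⟩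
  have hle : ∫⁻ ω, ‖entry a i j ω‖ₑ ^ k ∂P ≤
      ⨆ (p : ℕ) (q : ℕ) (_ : p ≤ q), ∫⁻ ω, ‖a p q ω‖ₑ ^ k ∂P :=
    le_iSup_of_le (min i j) (le_iSup_of_le (max i j) (le_iSup_of_le min_le_max le_rfl))
  have hm : AEStronglyMeasurable (fun ω => |entry a i j ω| ^ k) P :=
    ((H.measurable_entry i j).norm.pow_const k).aestronglyMeasurable
  have heq : ∀ ω, ENNReal.ofReal (|entry a i j ω| ^ k) = ‖entry a i j ω‖ₑ ^ k := fun ω => by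
    rw [ENNReal.ofReal_pow (abs_nonneg _), ← Real.norm_eq_abs, ofReal_norm]
  constructor
  · refine ⟨hm, ?_⟩
    rw [hasFiniteIntegral_iff_ofReal (ae_of_all _ fun ω => by positivity)]
    simp only [heq]
    exact hle.trans_lt (H.mom k)
  · rw [integral_eq_lintegral_of_nonneg_ae (ae_of_all _ fun ω => by positivity) hm]
    simp only [heq]
    exact ENNReal.toReal_mono (H.mom k).ne hle

theorem measurable_prod_entry (H : IndependentDiagonals P a Cov) {ι : Type*} (s : Finset ι)
    (u v : ι → ℕ) : Measurable fun ω => ∏ e ∈ s, entry a (u e) (v e) ω :=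
  Finset.measurable_fun_prod _ fun _ _ => H.measurable_entry _ _

theorem exists_prod_bound [IsProbabilityMeasure P] (H : IndependentDiagonals P a Cov) (K : ℕ) :
    ∃ C : ℝ, 1 ≤ C ∧ ∀ (ι : Type) (s : Finset ι) (u v : ι → ℕ), s.card ≤ K →
      Integrable (fun ω => ∏ e ∈ s, entry a (u e) (v e) ω) P ∧
      |∫ ω, ∏ e ∈ s, entry a (u e) (v e) ω ∂P| ≤ C := by
  obtain ⟨B, hB0, hB⟩ := H.exists_moment_bound K
  refine ⟨1 + K * B, by nlinarith [(Nat.cast_nonneg K : (0 : ℝ) ≤ K)], fun ι s u v hs => ?_⟩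
  have hint : Integrable (fun ω => 1 + ∑ e ∈ s, |entry a (u e) (v e) ω| ^ K) P :=
    (integrable_const _).add (integrable_finsetSum _ fun e _ => (hB _ _).1)
  have hle : ∀ ω, ‖∏ e ∈ s, entry a (u e) (v e) ω‖ ≤
      1 + ∑ e ∈ s, |entry a (u e) (v e) ω| ^ K := fun ω => by
    rw [Real.norm_eq_abs, Finset.abs_prod]
    exact s.prod_abs_le_one_add_sum_pow _ hs
  refine ⟨hint.mono' (H.measurable_prod_entry s u v).aestronglyMeasurable (ae_of_all _ hle), ?_⟩
  rw [← Real.norm_eq_abs]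
  refine (norm_integral_le_of_norm_le hint (ae_of_all _ hle)).trans ?_
  rw [integral_add (integrable_const _) (integrable_finsetSum _ fun e _ => (hB _ _).1),
    integral_finsetSum _ fun e _ => (hB _ _).1]
  have : ∑ e ∈ s, ∫ ω, |entry a (u e) (v e) ω| ^ K ∂P ≤ K * B := by
    refine (Finset.sum_le_card_nsmul _ _ B fun e _ => (hB _ _).2).trans ?_
    rw [nsmul_eq_mul]
    gcongr
  simpa using this

theorem integrable_prod [IsProbabilityMeasure P] (H : IndependentDiagonals P a Cov) {ι : Type}
    (s : Finset ι) (u v : ι → ℕ) : Integrable (fun ω => ∏ e ∈ s, entry a (u e) (v e) ω) P := by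
  obtain ⟨C, -, hC⟩ := H.exists_prod_bound s.card
  exact (hC ι s u v le_rfl).1

/-- Joint moments factorise over disjoint sets of diagonals. -/
theorem integral_prod_mul_prod (H : IndependentDiagonals P a Cov) {ι : Type*} (s t : Finset ι)
    (u v : ι → ℕ)
    (hst : ∀ e ∈ s, ∀ e' ∈ t, diagIndex (u e) (v e) ≠ diagIndex (u e') (v e')) :
    ∫ ω, (∏ e ∈ s, entry a (u e) (v e) ω) * ∏ e ∈ t, entry a (u e) (v e) ω ∂P =
      (∫ ω, ∏ e ∈ s, entry a (u e) (v e) ω ∂P) * ∫ ω, ∏ e ∈ t, entry a (u e) (v e) ω ∂P := by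
  classical
  let D : ι → ℕ := fun e => diagIndex (u e) (v e)
  have hdisj : Disjoint (s.image D) (t.image D) := by
    rw [Finset.disjoint_left]
    intro x hx hx'
    obtain ⟨e, he, rfl⟩ := Finset.mem_image.1 hx
    obtain ⟨e', he', h⟩ := Finset.mem_image.1 hx'
    exact hst e he e' he' h.symm
  have hmeas : ∀ r : ℕ, Measurable fun (ω : Ω) (p : ℕ) => a p (p + r) ω := fun r =>
    measurable_pi_iff.2 fun p => H.meas _ _ (Nat.le_add_right _ _)
  have hI := H.indep.indepFun_finset _ _ hdisj hmeas
  have key : ∀ w : Finset ι, ∃ φ : (↥(w.image D) → ℕ → ℝ) → ℝ, Measurable φ ∧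
      (fun ω => ∏ e ∈ w, entry a (u e) (v e) ω) =
        φ ∘ fun ω (r : ↥(w.image D)) p => a p (p + r) ω := by
    intro w
    refine ⟨fun f => ∏ e : w, f ⟨D e, Finset.mem_image_of_mem D e.2⟩ (min (u e) (v e)),
      Finset.measurable_fun_prod _ fun e _ => ?_, ?_⟩
    · exact (measurable_pi_apply _).comp (measurable_pi_apply _)
    · funext ω
      rw [← Finset.prod_coe_sort]
      simp only [Function.comp_apply, entry]
      refine Finset.prod_congr rfl fun e _ => ?_
      rw [show min (u e) (v e) + D e = max (u e) (v e) from min_add_diagIndex _ _]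
  obtain ⟨φ, hφ, hφe⟩ := key s
  obtain ⟨ψ, hψ, hψe⟩ := key t
  have hI2 := hI.comp hφ hψ
  rw [← hφe, ← hψe] at hI2
  exact hI2.integral_fun_mul_eq_mul_integral
    (H.measurable_prod_entry s u v).aestronglyMeasurable
    (H.measurable_prod_entry t u v).aestronglyMeasurable

theorem integral_entry (H : IndependentDiagonals P a Cov) (i j : ℕ) :
    ∫ ω, entry a i j ω ∂P = 0 := H.mean _ _ min_le_max

/-- A joint moment vanishes as soon as some diagonal is visited exactly once. -/
theorem integral_prod_eq_zero (H : IndependentDiagonals P a Cov) {ι : Type*} (s : Finset ι)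
    (u v : ι → ℕ) (e₀ : ι) (he₀ : e₀ ∈ s)
    (h : ∀ e ∈ s, e ≠ e₀ → diagIndex (u e) (v e) ≠ diagIndex (u e₀) (v e₀)) :
    ∫ ω, ∏ e ∈ s, entry a (u e) (v e) ω ∂P = 0 := by
  classical
  have := H.integral_prod_mul_prod {e₀} (s.erase e₀) u v (by
    intro e he e' he'
    rw [Finset.mem_singleton] at he
    subst he
    exact (h e' (Finset.mem_of_mem_erase he') (Finset.ne_of_mem_erase he')).symm)
  simp only [Finset.prod_singleton, H.integral_entry, zero_mul] at this
  rw [← this]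
  refine integral_congr_ae (ae_of_all _ fun ω => ?_)
  exact (Finset.mul_prod_erase s (fun e => entry a (u e) (v e) ω) he₀).symm

theorem integral_entry_mul_entry (H : IndependentDiagonals P a Cov) (p q τ : ℕ) :
    ∫ ω, entry a p q ω * entry a (p + τ) (q + τ) ω ∂P = Cov τ := by
  have h := H.cov τ (min p q) (max p q) min_le_max
  rw [covariance, H.mean _ _ min_le_max, H.mean _ _ (by omega)] at h
  simpa [entry, min_add_add_right, max_add_add_right] using h

/-- Two entries on the same diagonal. -/
theorem integral_entry_mul_entry_shift (H : IndependentDiagonals P a Cov) (p q p' q' : ℕ) (L : ℤ)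
    (hp : (p' : ℤ) = p + L) (hq : (q' : ℤ) = q + L) :
    ∫ ω, entry a p q ω * entry a p' q' ω ∂P = Cov L.natAbs := by
  rcases le_total 0 L with h | h
  · obtain rfl : p' = p + L.natAbs := by omega
    obtain rfl : q' = q + L.natAbs := by omega
    exact H.integral_entry_mul_entry p q _
  · obtain rfl : p = p' + L.natAbs := by omega
    obtain rfl : q = q' + L.natAbs := by omega
    simp only [mul_comm (entry a (p' + _) _ _)]
    exact H.integral_entry_mul_entry p' q' _

theorem integral_entry_sq (H : IndependentDiagonals P a Cov) (p q : ℕ) :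
    ∫ ω, entry a p q ω * entry a p q ω ∂P = 1 := by
  simp only [← sq]
  exact H.var _ _ min_le_max

theorem cov_zero (H : IndependentDiagonals P a Cov) : Cov 0 = 1 := by
  rw [← H.integral_entry_sq 0 0]
  exact (H.integral_entry_mul_entry 0 0 0).symm

end IndependentDiagonals

/-! ### Counting with linear constraints -/

theorem Finset.sum_comp_le_card_mul_tsum {α β : Type*} (S : Finset α) (f : α → β) (R : Finset β)
    (hf : ∀ x ∈ S, f x ∈ R) (h : α → ℤ)
    (hinj : ∀ x ∈ S, ∀ y ∈ S, f x = f y → h x = h y → x = y) (g : ℤ → ℝ) (hg0 : ∀ z, 0 ≤ g z)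
    (hg : Summable g) : ∑ x ∈ S, g (h x) ≤ R.card * ∑' z, g z := by
  classical
  rw [← Finset.sum_fiberwise_of_maps_to hf]
  refine (Finset.sum_le_card_nsmul _ _ (∑' z, g z) fun y _ => ?_).trans_eq (nsmul_eq_mul _ _)
  rw [← Finset.sum_image (f := g) (g := h)]
  · exact hg.sum_le_tsum _ fun z _ => hg0 z
  · intro x hx y hy hxy
    simp only [Finset.coe_filter, Set.mem_ofPred_eq] at hx hy
    exact hinj x hx.1 y hy.1 (hx.2.trans hy.2.symm) hxy

section Pattern


/-- `rep` picks a representative in each class of edges with the same absolute difference and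
`sgn` records the sign relative to the representative. -/
def HasPattern {E : Type} (d : E → ℤ) (rep : E → E) (sgn : E → ℤˣ) : Prop :=
  (∀ e, d e = sgn e * d (rep e)) ∧ ∀ e e', (d e).natAbs = (d e').natAbs ↔ rep e = rep e'

theorem exists_hasPattern {E : Type} (d : E → ℤ) : ∃ rep sgn, HasPattern d rep sgn := by
  classical
  have hrep : ∃ rep : E → E, (∀ e, (d (rep e)).natAbs = (d e).natAbs) ∧
      ∀ e e', (d e).natAbs = (d e').natAbs → rep e = rep e' := by
    let s : ℕ → E → E := fun r e => if h : ∃ e', (d e').natAbs = r then h.choose else e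
    refine ⟨fun e => s (d e).natAbs e, fun e => ?_, fun e e' h => ?_⟩
    · have h : ∃ e', (d e').natAbs = (d e).natAbs := ⟨e, rfl⟩
      simp only [s, dif_pos h]
      exact h.choose_spec
    · have h1 : ∃ e'', (d e'').natAbs = (d e').natAbs := ⟨e', rfl⟩
      simp only [s, h, dif_pos h1]
  obtain ⟨rep, h1, h2⟩ := hrep
  refine ⟨rep, fun e => if d e = d (rep e) then 1 else -1, fun e => ?_, fun e e' => ⟨h2 e e', ?_⟩⟩
  · have := h1 e
    dsimp only
    split_ifs with h
    · simpa using h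
    · have h3 : d e = -d (rep e) := by omega
      simpa using h3
  · intro h
    rw [← h1 e, ← h1 e', h]

variable {E : Type} [Fintype E] [DecidableEq E]

theorem two_mul_card_image_le {rep : E → E} (h : ∀ e, ∃ e', e' ≠ e ∧ rep e' = rep e) :
    2 * (Finset.univ.image rep).card ≤ Fintype.card E := by
  rw [← Finset.card_univ, Finset.card_eq_sum_card_image rep Finset.univ, mul_comm,
    ← smul_eq_mul]
  refine Finset.card_nsmul_le_sum _ _ _ fun b hb => ?_
  obtain ⟨e, -, rfl⟩ := Finset.mem_image.1 hb
  obtain ⟨e', hne, he'⟩ := h e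
  exact Finset.one_lt_card.2 ⟨e', by simp [he'], e, by simp, hne⟩

/-- If the classes have at least two elements and their number is half the number of edges, then
they are pairs. -/
theorem exists_partner {rep : E → E} (h : ∀ e, ∃ e', e' ≠ e ∧ rep e' = rep e)
    (hc : 2 * (Finset.univ.image rep).card = Fintype.card E) (e : E) :
    ∃ e', e' ≠ e ∧ rep e' = rep e ∧ ∀ x, rep x = rep e → x = e ∨ x = e' := by
  have h2 : ∀ b ∈ Finset.univ.image rep, 2 ≤ (Finset.univ.filter fun x => rep x = b).card := by
    intro b hb
    obtain ⟨e, -, rfl⟩ := Finset.mem_image.1 hb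
    obtain ⟨e', hne, he'⟩ := h e
    exact Finset.one_lt_card.2 ⟨e', by simp [he'], e, by simp, hne⟩
  have hsum : ∑ _b ∈ Finset.univ.image rep, 2 =
      ∑ b ∈ Finset.univ.image rep, (Finset.univ.filter fun x => rep x = b).card := by
    rw [← Finset.card_eq_sum_card_image rep Finset.univ, Finset.card_univ, ← hc,
      Finset.sum_const, smul_eq_mul, mul_comm]
  have hall := (Finset.sum_eq_sum_iff_of_le h2).1 hsum (rep e)
    (Finset.mem_image_of_mem _ (Finset.mem_univ e))
  obtain ⟨x, y, hxy, hs⟩ := Finset.card_eq_two.1 hall.symm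
  have hmem : ∀ z, rep z = rep e ↔ z = x ∨ z = y := fun z => by
    have : z ∈ Finset.univ.filter (fun x => rep x = rep e) ↔ z ∈ ({x, y} : Finset E) := by
      rw [hs]
    simpa using this
  rcases (hmem e).1 rfl with rfl | rfl
  · exact ⟨y, hxy.symm, (hmem y).2 (Or.inr rfl), fun z hz => (hmem z).1 hz⟩
  · exact ⟨x, hxy, (hmem x).2 (Or.inl rfl), fun z hz => ((hmem z).1 hz).symm⟩

variable {α ρ : Type*} (S : Finset α) (d : α → E → ℤ) (base : α → ρ) (R : Finset ρ) (N : ℕ)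
  (rep : E → E) (sgn : E → ℤˣ)

theorem sum_mul_eq_sum_image {x : E → ℤ} (hx : ∀ e, x e = sgn e * x (rep e)) (c : E → ℤ) :
    ∑ e, c e * x e = ∑ b ∈ Finset.univ.image rep,
      (∑ e with rep e = b, c e * sgn e) * x b := by
  rw [← Finset.sum_fiberwise_of_maps_to (s := Finset.univ) (t := Finset.univ.image rep) (g := rep)
    (fun e _ => Finset.mem_image_of_mem _ (Finset.mem_univ e))]
  refine Finset.sum_congr rfl fun b _ => ?_
  rw [Finset.sum_mul]
  refine Finset.sum_congr rfl fun e he => ?_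
  rw [Finset.mem_filter] at he
  rw [hx e, he.2, mul_assoc]

theorem sum_weight_le (hbase : ∀ x ∈ S, base x ∈ R) (hd : ∀ x ∈ S, ∀ e, (d x e).natAbs ≤ N)
    (hinj : ∀ x ∈ S, ∀ y ∈ S, base x = base y → d x = d y → x = y)
    (hpat : ∀ x ∈ S, ∀ e, d x e = sgn e * d x (rep e)) (c : E → ℤ) (B : E)
    (hB : ∑ e with rep e = B, c e * sgn e ≠ 0) (g : ℤ → ℝ) (hg0 : ∀ z, 0 ≤ g z)
    (hg : Summable g) :
    ∑ x ∈ S, g (∑ e, c e * d x e) ≤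
      (R.card * (2 * N + 1) ^ ((Finset.univ.image rep).card - 1) : ℕ) * ∑' z, g z := by
  have hBI : B ∈ Finset.univ.image rep := by
    by_contra hcon
    apply hB
    rw [Finset.filter_eq_empty_iff.2, Finset.sum_empty]
    intro e _ he
    exact hcon (he ▸ Finset.mem_image_of_mem _ (Finset.mem_univ e))
  have key := Finset.sum_comp_le_card_mul_tsum S
    (fun x => (base x, fun e : ↥((Finset.univ.image rep).erase B) => d x e))
    (R ×ˢ Fintype.piFinset fun _ => Finset.Icc (-(N : ℤ)) N)
    (by
      intro x hx
      rw [Finset.mem_product, Fintype.mem_piFinset]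
      refine ⟨hbase x hx, fun e => ?_⟩
      have := hd x hx e
      change d x e ∈ Finset.Icc (-(N : ℤ)) N
      rw [Finset.mem_Icc]
      constructor <;> omega)
    (fun x => ∑ e, c e * d x e)
    (by
      intro x hx y hy hxy hh
      rw [Prod.mk.injEq] at hxy
      have h1 : ∀ e ∈ (Finset.univ.image rep).erase B, d x e = d y e := fun e he =>
        congrFun hxy.2 ⟨e, he⟩
      have h2 : d x B = d y B := by
        rw [sum_mul_eq_sum_image rep sgn (hpat x hx), sum_mul_eq_sum_image rep sgn (hpat y hy),
          ← Finset.add_sum_erase _ _ hBI, ← Finset.add_sum_erase _ _ hBI] at hh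
        have h3 : ∑ b ∈ (Finset.univ.image rep).erase B, (∑ e with rep e = b, c e * sgn e) * d x b =
            ∑ b ∈ (Finset.univ.image rep).erase B, (∑ e with rep e = b, c e * sgn e) * d y b :=
          Finset.sum_congr rfl fun b hb => by rw [h1 b hb]
        rw [h3] at hh
        exact mul_left_cancel₀ hB (add_right_cancel hh)
      refine hinj x hx y hy hxy.1 (funext fun e => ?_)
      rw [hpat x hx, hpat y hy]
      congr 1
      by_cases he : rep e = B
      · rw [he, h2]
      · exact h1 _ (Finset.mem_erase.2 ⟨he, Finset.mem_image_of_mem _ (Finset.mem_univ e)⟩))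
    g hg0 hg
  refine key.trans_eq ?_
  rw [Finset.card_product, Fintype.card_piFinset, Finset.prod_const, Int.card_Icc, Finset.card_univ,
    Fintype.card_coe, Finset.card_erase_of_mem hBI]
  congr 4
  omega

theorem card_le_of_pattern (hbase : ∀ x ∈ S, base x ∈ R) (hd : ∀ x ∈ S, ∀ e, (d x e).natAbs ≤ N)
    (hinj : ∀ x ∈ S, ∀ y ∈ S, base x = base y → d x = d y → x = y)
    (hpat : ∀ x ∈ S, ∀ e, d x e = sgn e * d x (rep e)) :
    S.card ≤ R.card * (2 * N + 1) ^ (Finset.univ.image rep).card := by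
  have key := Finset.card_le_card_of_injOn
    (s := S) (t := R ×ˢ Fintype.piFinset fun _ => Finset.Icc (-(N : ℤ)) N)
    (fun x => (base x, fun e : ↥(Finset.univ.image rep) => d x e))
    (by
      intro x hx
      rw [Finset.mem_coe, Finset.mem_product, Fintype.mem_piFinset]
      refine ⟨hbase x hx, fun e => ?_⟩
      have := hd x hx e
      change d x e ∈ Finset.Icc (-(N : ℤ)) N
      rw [Finset.mem_Icc]
      constructor <;> omega)
    (by
      intro x hx y hy hxy
      simp only [Prod.mk.injEq] at hxy
      refine hinj x hx y hy hxy.1 (funext fun e => ?_)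
      rw [hpat x hx, hpat y hy]
      congr 1
      exact congrFun hxy.2 ⟨rep e, Finset.mem_image_of_mem _ (Finset.mem_univ e)⟩)
  refine key.trans_eq ?_
  rw [Finset.card_product, Fintype.card_piFinset, Finset.prod_const, Int.card_Icc, Finset.card_univ,
    Fintype.card_coe]
  congr 2
  omega

/-- One nontrivial linear relation among the differences saves one degree of freedom. -/
theorem card_le_of_relation (hbase : ∀ x ∈ S, base x ∈ R)
    (hd : ∀ x ∈ S, ∀ e, (d x e).natAbs ≤ N)
    (hinj : ∀ x ∈ S, ∀ y ∈ S, base x = base y → d x = d y → x = y)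
    (hpat : ∀ x ∈ S, ∀ e, d x e = sgn e * d x (rep e)) (c : E → ℤ) (B : E)
    (hB : ∑ e with rep e = B, c e * sgn e ≠ 0) (hc : ∀ x ∈ S, ∑ e, c e * d x e = 0) :
    S.card ≤ R.card * (2 * N + 1) ^ ((Finset.univ.image rep).card - 1) := by
  have h := sum_weight_le S d base R N rep sgn hbase hd hinj hpat c B hB
    (fun z => if z = 0 then 1 else 0) (fun z => by positivity)
    (summable_of_ne_finset_zero (s := {0}) fun z hz => by simpa using hz)
  rw [Finset.sum_congr rfl fun x hx => by rw [hc x hx], tsum_ite_eq] at h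
  simp only [if_true, Finset.sum_const, nsmul_eq_mul, mul_one] at h
  exact_mod_cast h

/-- To bound a nonnegative sum it suffices to bound its part over each pattern. -/
theorem sum_le_of_pattern (F : α → ℝ) (M : ℝ)
    (h : ∀ rep sgn, ∀ T ⊆ S, (∀ x ∈ T, HasPattern (d x) rep sgn) → ∑ x ∈ T, F x ≤ M) :
    ∑ x ∈ S, F x ≤ Fintype.card ((E → E) × (E → ℤˣ)) * M := by
  classical
  choose rep sgn hp using fun x => exists_hasPattern (d x)
  rw [← Finset.sum_fiberwise_of_maps_to (s := S) (t := Finset.univ)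
    (g := fun x => (rep x, sgn x)) (fun _ _ => Finset.mem_univ _)]
  refine (Finset.sum_le_card_nsmul _ _ M fun y _ => ?_).trans_eq ?_
  · refine h y.1 y.2 _ (Finset.filter_subset _ _) fun x hx => ?_
    rw [Finset.mem_filter] at hx
    rw [← hx.2]
    exact hp x
  · rw [nsmul_eq_mul, Finset.card_univ]

end Pattern

theorem two_mul_add_one_pow_le {n : ℕ} (hn : 1 ≤ n) {m K : ℕ} (hm : m ≤ K) :
    (2 * n + 1) ^ m ≤ 3 ^ K * n ^ m := by
  calc (2 * n + 1) ^ m ≤ (3 * n) ^ m := Nat.pow_le_pow_left (by omega) _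
    _ = 3 ^ m * n ^ m := mul_pow _ _ _
    _ ≤ _ := Nat.mul_le_mul_right _ (Nat.pow_le_pow_right (by norm_num) hm)

/-! ### Closed walks -/

/-- Closed walks of length `k` on the vertices `0, …, n - 1`. -/
def closedWalks (k n : ℕ) : Finset (Fin (k + 1) → ℕ) :=
  (Fintype.piFinset fun _ => Finset.range n).filter fun p => p 0 = p (Fin.last k)

theorem mem_closedWalks {k n : ℕ} {p : Fin (k + 1) → ℕ} :
    p ∈ closedWalks k n ↔ (∀ v, p v < n) ∧ p 0 = p (Fin.last k) := by
  simp [closedWalks]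

/-- The product of the entries along a walk. -/
noncomputable def walkWeight {Ω : Type*} (a : ℕ → ℕ → Ω → ℝ) {k : ℕ} (p : Fin (k + 1) → ℕ)
    (ω : Ω) : ℝ :=
  ∏ e : Fin k, entry a (p e.castSucc) (p e.succ) ω

/-- The sum of the weights of all closed walks, which is the trace of the `k`-th power of the
unnormalised matrix. -/
noncomputable def walkSum {Ω : Type*} (a : ℕ → ℕ → Ω → ℝ) (k n : ℕ) (ω : Ω) : ℝ :=
  ∑ p ∈ closedWalks k n, walkWeight a p ω

/-- The increments of a walk. -/
def step {k : ℕ} (p : Fin (k + 1) → ℕ) (e : Fin k) : ℤ := (p e.succ : ℤ) - p e.castSucc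

theorem natAbs_step_le {k n : ℕ} {p : Fin (k + 1) → ℕ} (hp : p ∈ closedWalks k n) (e : Fin k) :
    (step p e).natAbs ≤ n := by
  rw [mem_closedWalks] at hp
  have h1 := hp.1 e.succ
  have h2 := hp.1 e.castSucc
  unfold step
  omega

theorem sum_step_interval {k : ℕ} (p : Fin (k + 1) → ℕ) (s t : Fin (k + 1)) (hst : s ≤ t) :
    ∑ e : Fin k, (if (s : ℕ) ≤ e ∧ (e : ℕ) < t then 1 else 0) * step p e = (p t : ℤ) - p s := by
  let Q : ℕ → ℤ := fun l => if h : l < k + 1 then p ⟨l, h⟩ else 0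
  have hQ : ∀ e : Fin k, step p e = Q (e + 1) - Q e := fun e => by
    have h1 : (e : ℕ) + 1 < k + 1 := by omega
    have h2 : (e : ℕ) < k + 1 := by omega
    simp only [Q, dif_pos h1, dif_pos h2]
    rfl
  have hQv : ∀ v : Fin (k + 1), (p v : ℤ) = Q v := fun v => by
    simp only [Q, dif_pos v.2]
  have hst' : (s : ℕ) ≤ t := hst
  rw [hQv, hQv, ← Finset.sum_Ico_sub Q hst']
  simp only [hQ, ite_mul, one_mul, zero_mul]
  rw [Fin.sum_univ_eq_sum_range
    (fun e => if (s : ℕ) ≤ e ∧ e < t then Q (e + 1) - Q e else 0), ← Finset.sum_filter]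
  congr 1
  ext e
  simp only [Finset.mem_filter, Finset.mem_range, Finset.mem_Ico]
  omega

theorem walk_ext {k : ℕ} {p q : Fin (k + 1) → ℕ} (v : Fin (k + 1)) (hv : p v = q v)
    (h : step p = step q) : p = q := by
  have key : ∀ t, (p t : ℤ) - p 0 = q t - q 0 := fun t => by
    rw [← sum_step_interval p 0 t (Fin.zero_le t), ← sum_step_interval q 0 t (Fin.zero_le t), h]
  funext t
  have h1 := key t
  have h2 := key v
  omega

theorem sum_step_eq_zero {k n : ℕ} {p : Fin (k + 1) → ℕ} (hp : p ∈ closedWalks k n) :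
    ∑ e, step p e = 0 := by
  have h := sum_step_interval p 0 (Fin.last k) (Fin.zero_le _)
  rw [(mem_closedWalks.1 hp).2] at h
  simpa using h

theorem closedWalks_mono (k : ℕ) {n m : ℕ} (h : n ≤ m) : closedWalks k n ⊆ closedWalks k m := by
  intro p hp
  rw [mem_closedWalks] at hp ⊢
  exact ⟨fun v => (hp.1 v).trans_le h, hp.2⟩

/-- The increments of a pair of walks. -/
def pairStep {k : ℕ} (x : (Fin (k + 1) → ℕ) × (Fin (k + 1) → ℕ)) : Fin k ⊕ Fin k → ℤ :=
  Sum.elim (step x.1) (step x.2)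

def pairSource {k : ℕ} (x : (Fin (k + 1) → ℕ) × (Fin (k + 1) → ℕ)) : Fin k ⊕ Fin k → ℕ :=
  Sum.elim (fun e => x.1 e.castSucc) (fun e => x.2 e.castSucc)

def pairTarget {k : ℕ} (x : (Fin (k + 1) → ℕ) × (Fin (k + 1) → ℕ)) : Fin k ⊕ Fin k → ℕ :=
  Sum.elim (fun e => x.1 e.succ) (fun e => x.2 e.succ)

theorem diagIndex_pair {k : ℕ} (x : (Fin (k + 1) → ℕ) × (Fin (k + 1) → ℕ)) (e : Fin k ⊕ Fin k) :
    diagIndex (pairSource x e) (pairTarget x e) = (pairStep x e).natAbs := by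
  cases e <;> rfl

theorem natAbs_pairStep_le {k n : ℕ} {x : (Fin (k + 1) → ℕ) × (Fin (k + 1) → ℕ)}
    (hx : x ∈ closedWalks k n ×ˢ closedWalks k n) (e : Fin k ⊕ Fin k) :
    (pairStep x e).natAbs ≤ n := by
  rw [Finset.mem_product] at hx
  cases e
  · exact natAbs_step_le hx.1 _
  · exact natAbs_step_le hx.2 _

theorem pair_ext {k : ℕ} {x y : (Fin (k + 1) → ℕ) × (Fin (k + 1) → ℕ)} (v w : Fin (k + 1))
    (hv : x.1 v = y.1 v) (hw : x.2 w = y.2 w) (h : pairStep x = pairStep y) : x = y :=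
  Prod.ext (walk_ext v hv (funext fun e => congrFun h (Sum.inl e)))
    (walk_ext w hw (funext fun e => congrFun h (Sum.inr e)))

theorem prod_pair {Ω : Type*} (a : ℕ → ℕ → Ω → ℝ) {k : ℕ}
    (x : (Fin (k + 1) → ℕ) × (Fin (k + 1) → ℕ)) (ω : Ω) :
    ∏ e, entry a (pairSource x e) (pairTarget x e) ω = walkWeight a x.1 ω * walkWeight a x.2 ω :=
  Fintype.prod_sum_type _

namespace IndependentDiagonals

variable {Ω : Type*} [MeasurableSpace Ω] {P : Measure Ω}
  {a : ℕ → ℕ → Ω → ℝ} {Cov : ℕ → ℝ}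

theorem integral_pair_eq_zero (H : IndependentDiagonals P a Cov) {k : ℕ}
    (x : (Fin (k + 1) → ℕ) × (Fin (k + 1) → ℕ)) (e : Fin k ⊕ Fin k)
    (he : ∀ e', e' ≠ e → (pairStep x e').natAbs ≠ (pairStep x e).natAbs) :
    ∫ ω, walkWeight a x.1 ω * walkWeight a x.2 ω ∂P = 0 := by
  simp only [← prod_pair]
  refine H.integral_prod_eq_zero Finset.univ _ _ e (Finset.mem_univ _) fun e' _ hne => ?_
  rw [diagIndex_pair, diagIndex_pair]
  exact he e' hne

theorem integral_walk_eq_zero (H : IndependentDiagonals P a Cov) {k : ℕ}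
    (p : Fin (k + 1) → ℕ) (e : Fin k)
    (he : ∀ e', e' ≠ e → (step p e').natAbs ≠ (step p e).natAbs) :
    ∫ ω, walkWeight a p ω ∂P = 0 :=
  H.integral_prod_eq_zero Finset.univ _ _ e (Finset.mem_univ _) fun e' _ hne => he e' hne

theorem integral_pair_eq_mul (H : IndependentDiagonals P a Cov) {k : ℕ}
    (x : (Fin (k + 1) → ℕ) × (Fin (k + 1) → ℕ))
    (h : ∀ e e', (step x.1 e).natAbs ≠ (step x.2 e').natAbs) :
    ∫ ω, walkWeight a x.1 ω * walkWeight a x.2 ω ∂P =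
      (∫ ω, walkWeight a x.1 ω ∂P) * ∫ ω, walkWeight a x.2 ω ∂P := by
  have := H.integral_prod_mul_prod (ι := Fin k ⊕ Fin k)
    (Finset.univ.map Function.Embedding.inl) (Finset.univ.map Function.Embedding.inr)
    (pairSource x) (pairTarget x) (by
      intro e he e' he'
      obtain ⟨e, -, rfl⟩ := Finset.mem_map.1 he
      obtain ⟨e', -, rfl⟩ := Finset.mem_map.1 he'
      exact h e e')
  simp only [Finset.prod_map] at this
  exact this

theorem measurable_walkWeight (H : IndependentDiagonals P a Cov) {k : ℕ} (p : Fin (k + 1) → ℕ) :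
    Measurable (walkWeight a p) := H.measurable_prod_entry _ _ _

theorem measurable_walkSum (H : IndependentDiagonals P a Cov) (k n : ℕ) :
    Measurable (walkSum a k n) :=
  Finset.measurable_fun_sum _ fun _ _ => H.measurable_walkWeight _

variable [IsProbabilityMeasure P]

theorem integrable_walkWeight (H : IndependentDiagonals P a Cov) {k : ℕ} (p : Fin (k + 1) → ℕ) :
    Integrable (walkWeight a p) P := H.integrable_prod _ _ _

theorem integrable_pair (H : IndependentDiagonals P a Cov) {k : ℕ} (p q : Fin (k + 1) → ℕ) :
    Integrable (fun ω => walkWeight a p ω * walkWeight a q ω) P := by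
  simp only [fun ω => (prod_pair a (p, q) ω).symm]
  exact H.integrable_prod _ _ _

theorem integrable_walkSum (H : IndependentDiagonals P a Cov) (k n : ℕ) :
    Integrable (walkSum a k n) P :=
  integrable_finsetSum _ fun _ _ => H.integrable_walkWeight _

theorem exists_pair_bound (H : IndependentDiagonals P a Cov) (k : ℕ) :
    ∃ C : ℝ, 1 ≤ C ∧ ∀ p q : Fin (k + 1) → ℕ, |∫ ω, walkWeight a p ω ∂P| ≤ C ∧
      |∫ ω, walkWeight a p ω * walkWeight a q ω ∂P| ≤ C := by
  obtain ⟨C, hC1, hC⟩ := H.exists_prod_bound (k + k)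
  refine ⟨C, hC1, fun p q => ⟨(hC (Fin k) Finset.univ _ _ (by simp)).2, ?_⟩⟩
  simp only [fun ω => (prod_pair a (p, q) ω).symm]
  exact (hC (Fin k ⊕ Fin k) Finset.univ _ _ (by simp)).2

theorem integral_sum_mul_sum (H : IndependentDiagonals P a Cov) {k : ℕ}
    (T : Finset (Fin (k + 1) → ℕ)) :
    ∫ ω, (∑ p ∈ T, walkWeight a p ω) ^ 2 ∂P =
      ∑ x ∈ T ×ˢ T, ∫ ω, walkWeight a x.1 ω * walkWeight a x.2 ω ∂P := by
  rw [← integral_finsetSum _ fun x _ => H.integrable_pair x.1 x.2]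
  simp only [sq, Finset.sum_mul_sum, Finset.sum_product]

theorem integrable_sum_sq (H : IndependentDiagonals P a Cov) {k : ℕ}
    (T : Finset (Fin (k + 1) → ℕ)) :
    Integrable (fun ω => (∑ p ∈ T, walkWeight a p ω) ^ 2) P := by
  simp only [sq, Finset.sum_mul_sum]
  exact integrable_finsetSum _ fun p _ => integrable_finsetSum _ fun q _ => H.integrable_pair p q

theorem integrable_walkSum_sub_sq (H : IndependentDiagonals P a Cov) (k n : ℕ) (c : ℝ) :
    Integrable (fun ω => (walkSum a k n ω - c) ^ 2) P := by
  have : (fun ω => (walkSum a k n ω - c) ^ 2) =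
      fun ω => walkSum a k n ω ^ 2 - 2 * c * walkSum a k n ω + c ^ 2 := by
    funext ω; ring
  rw [this]
  exact ((H.integrable_sum_sq _).sub ((H.integrable_walkSum k n).const_mul _)).add
    (integrable_const _)

theorem integral_walkSum_sub_mean_sq (H : IndependentDiagonals P a Cov) (k n : ℕ) :
    ∫ ω, (walkSum a k n ω - ∫ ω, walkSum a k n ω ∂P) ^ 2 ∂P =
      ∑ x ∈ closedWalks k n ×ˢ closedWalks k n,
        ((∫ ω, walkWeight a x.1 ω * walkWeight a x.2 ω ∂P) -
          (∫ ω, walkWeight a x.1 ω ∂P) * ∫ ω, walkWeight a x.2 ω ∂P) := by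
  set m := ∫ ω, walkSum a k n ω ∂P with hm
  have : (fun ω => (walkSum a k n ω - m) ^ 2) =
      fun ω => (walkSum a k n ω ^ 2 - 2 * m * walkSum a k n ω) + m ^ 2 := by
    funext ω; ring
  have hi := (H.integrable_walkSum k n).const_mul (2 * m)
  have hs : Integrable (fun ω => walkSum a k n ω ^ 2) P := H.integrable_sum_sq (closedWalks k n)
  have hsi : Integrable (fun ω => walkSum a k n ω ^ 2 - 2 * m * walkSum a k n ω) P := hs.sub hi
  rw [this, integral_add hsi (integrable_const _), integral_sub hs hi,
    integral_const_mul, ← hm, Finset.sum_sub_distrib, ← H.integral_sum_mul_sum]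
  have h2 : ∑ x ∈ closedWalks k n ×ˢ closedWalks k n,
      (∫ ω, walkWeight a x.1 ω ∂P) * ∫ ω, walkWeight a x.2 ω ∂P = m ^ 2 := by
    rw [hm, Finset.sum_product]
    dsimp only
    rw [← Finset.sum_mul_sum, sq]
    simp only [walkSum]
    rw [integral_finsetSum _ fun p _ => H.integrable_walkWeight p]
  rw [h2]
  simp only [walkSum, integral_const, probReal_univ, one_smul]
  ring

/-- The variance of the trace of the `k`-th power. -/
theorem exists_variance_bound (H : IndependentDiagonals P a Cov) (k : ℕ) :
    ∃ C : ℝ, 0 ≤ C ∧ ∀ n, 1 ≤ n →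
      ∫ ω, (walkSum a k n ω - ∫ ω, walkSum a k n ω ∂P) ^ 2 ∂P ≤ C * (n : ℝ) ^ (k + 1) := by
  obtain ⟨C, hC1, hC⟩ := H.exists_pair_bound k
  have hC0 : 0 ≤ C := by linarith
  refine ⟨Fintype.card (((Fin k ⊕ Fin k) → (Fin k ⊕ Fin k)) × ((Fin k ⊕ Fin k) → ℤˣ)) *
    ((3 ^ k : ℕ) * (C + C * C)), by positivity, fun n hn => ?_⟩
  rw [H.integral_walkSum_sub_mean_sq, mul_assoc]
  refine (Finset.sum_le_sum fun x _ => le_abs_self _).trans ?_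
  refine sum_le_of_pattern _ pairStep _ _ fun rep sgn T hT hpat => ?_
  by_cases hsing : ∀ e, ∃ e', e' ≠ e ∧ rep e' = rep e
  swap
  · push Not at hsing
    obtain ⟨e, he⟩ := hsing
    rw [Finset.sum_eq_zero]
    · positivity
    intro x hx
    have hne : ∀ e', e' ≠ e → (pairStep x e').natAbs ≠ (pairStep x e).natAbs := fun e' hne h =>
      he e' hne (((hpat x hx).2 _ _).1 h)
    rw [H.integral_pair_eq_zero x e hne]
    rcases e with e | e
    · rw [H.integral_walk_eq_zero x.1 e fun e' h => hne (Sum.inl e') (by simpa using h)]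
      simp
    · rw [H.integral_walk_eq_zero x.2 e fun e' h => hne (Sum.inr e') (by simpa using h)]
      simp
  by_cases hshare : ∃ e e', rep (Sum.inl e) = rep (Sum.inr e')
  swap
  · push Not at hshare
    rw [Finset.sum_eq_zero]
    · positivity
    intro x hx
    rw [H.integral_pair_eq_mul x fun e e' h =>
      hshare e e' (((hpat x hx).2 (Sum.inl e) (Sum.inr e')).1 h), sub_self, abs_zero]
  obtain ⟨e, e', hee⟩ := hshare
  have hk : 1 ≤ k := e.pos
  have hcard : T.card ≤ 3 ^ k * n ^ (k + 1) := by
    have h2 := two_mul_card_image_le hsing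
    rw [Fintype.card_sum, Fintype.card_fin] at h2
    have hb : T.card ≤ (Finset.range n ×ˢ Finset.range n).card * (2 * n + 1) ^ (k - 1) := by
      have hbase : ∀ x ∈ T, (x.1 0, x.2 0) ∈ Finset.range n ×ˢ Finset.range n := fun x hx => by
        have := Finset.mem_product.1 (hT hx)
        rw [Finset.mem_product, Finset.mem_range, Finset.mem_range]
        exact ⟨(mem_closedWalks.1 this.1).1 0, (mem_closedWalks.1 this.2).1 0⟩
      have hd : ∀ x ∈ T, ∀ e, (pairStep x e).natAbs ≤ n := fun x hx =>
        natAbs_pairStep_le (hT hx)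
      have hinj : ∀ x ∈ T, ∀ y ∈ T, (x.1 0, x.2 0) = (y.1 0, y.2 0) → pairStep x = pairStep y →
          x = y := fun x _ y _ h h' =>
        pair_ext 0 0 (Prod.mk.inj h).1 (Prod.mk.inj h).2 h'
      by_cases heq : (Finset.univ.image rep).card = k
      · obtain ⟨e₂, hne, hrep, hfib⟩ := exists_partner hsing
          (by rw [heq, Fintype.card_sum, Fintype.card_fin, two_mul]) (Sum.inl e)
        have he₂ : e₂ = Sum.inr e' := by
          rcases hfib _ hee.symm with h | h
          · cases h
          · exact h.symm
        have hset : (Finset.univ.filter fun x => rep x = rep (Sum.inl e)) =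
            {Sum.inl e, Sum.inr e'} := by
          ext x
          simp only [Finset.mem_filter, Finset.mem_univ, true_and, Finset.mem_insert,
            Finset.mem_singleton]
          refine ⟨fun h => he₂ ▸ hfib x h, ?_⟩
          rintro (rfl | rfl)
          · rfl
          · exact hee.symm
        have := card_le_of_relation T pairStep (fun x => (x.1 0, x.2 0)) _ n rep sgn hbase hd hinj
          (fun x hx => (hpat x hx).1) (Sum.elim 1 0) (rep (Sum.inl e))
          (by rw [hset, Finset.sum_pair (by simp)]; simp)
          (fun x hx => by
            rw [Fintype.sum_sum_type]
            simpa [pairStep] using sum_step_eq_zero (Finset.mem_product.1 (hT hx)).1)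
        rwa [heq] at this
      · refine (card_le_of_pattern T pairStep (fun x => (x.1 0, x.2 0)) _ n rep sgn hbase hd hinj
          (fun x hx => (hpat x hx).1)).trans ?_
        exact Nat.mul_le_mul_left _ (Nat.pow_le_pow_right (by omega) (by omega))
    refine hb.trans ?_
    rw [Finset.card_product, Finset.card_range]
    calc n * n * (2 * n + 1) ^ (k - 1) ≤ n * n * (3 ^ k * n ^ (k - 1)) :=
          Nat.mul_le_mul_left _ (two_mul_add_one_pow_le hn (by omega))
      _ = 3 ^ k * (n ^ (k - 1) * n * n) := by ring
      _ = 3 ^ k * n ^ (k + 1) := by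
          rw [← pow_succ, ← pow_succ, Nat.sub_add_cancel hk]
  calc ∑ x ∈ T, |(∫ ω, walkWeight a x.1 ω * walkWeight a x.2 ω ∂P) -
          (∫ ω, walkWeight a x.1 ω ∂P) * ∫ ω, walkWeight a x.2 ω ∂P|
      ≤ ∑ _x ∈ T, (C + C * C) := by
        refine Finset.sum_le_sum fun x _ => (abs_sub _ _).trans ?_
        rw [abs_mul]
        gcongr
        · exact (hC x.1 x.2).2
        · exact (hC x.1 x.2).1
        · exact (hC x.2 x.1).1
    _ = T.card * (C + C * C) := by rw [Finset.sum_const, nsmul_eq_mul]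
    _ ≤ (3 ^ k * n ^ (k + 1) : ℕ) * (C + C * C) := by gcongr
    _ = _ := by push_cast; ring

/-- The second moment of the increments in `n` of the trace of the `k`-th power. -/
theorem exists_increment_bound (H : IndependentDiagonals P a Cov) (k : ℕ) :
    ∃ C : ℝ, 0 ≤ C ∧ ∀ n,
      ∫ ω, (walkSum a k (n + 1) ω - walkSum a k n ω) ^ 2 ∂P ≤ C * ((n : ℝ) + 1) ^ k := by
  obtain ⟨C, hC1, hC⟩ := H.exists_pair_bound k
  have hC0 : 0 ≤ C := by linarith
  refine ⟨Fintype.card (((Fin k ⊕ Fin k) → (Fin k ⊕ Fin k)) × ((Fin k ⊕ Fin k) → ℤˣ)) *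
    (((k + 1) ^ 2 * 3 ^ k : ℕ) * C), by positivity, fun n => ?_⟩
  set T₀ := closedWalks k (n + 1) \ closedWalks k n with hT₀
  have hsub : ∀ ω, walkSum a k (n + 1) ω - walkSum a k n ω = ∑ p ∈ T₀, walkWeight a p ω := by
    intro ω
    rw [walkSum, walkSum, sub_eq_iff_eq_add,
      Finset.sum_sdiff (closedWalks_mono k (Nat.le_succ n))]
  have htouch : ∀ p ∈ T₀, ∃ v, p v = n := by
    intro p hp
    rw [hT₀, Finset.mem_sdiff, mem_closedWalks, mem_closedWalks] at hp
    by_contra! hcon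
    exact hp.2 ⟨fun v => lt_of_le_of_ne (Nat.lt_succ_iff.1 (hp.1.1 v)) (hcon v), hp.1.2⟩
  have hv : ∀ p : Fin (k + 1) → ℕ, ∃ v, p ∈ T₀ → p v = n := fun p => by
    by_cases hp : p ∈ T₀
    · obtain ⟨v, hv⟩ := htouch p hp
      exact ⟨v, fun _ => hv⟩
    · exact ⟨0, fun h => absurd h hp⟩
  choose vtx hvtx using hv
  simp only [hsub]
  rw [H.integral_sum_mul_sum, mul_assoc]
  refine (Finset.sum_le_sum fun x _ => le_abs_self _).trans ?_
  refine sum_le_of_pattern _ pairStep _ _ fun rep sgn T hT hpat => ?_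
  by_cases hsing : ∀ e, ∃ e', e' ≠ e ∧ rep e' = rep e
  swap
  · push Not at hsing
    obtain ⟨e, he⟩ := hsing
    rw [Finset.sum_eq_zero]
    · positivity
    intro x hx
    rw [H.integral_pair_eq_zero x e fun e' hne h => he e' hne (((hpat x hx).2 _ _).1 h), abs_zero]
  have hcard : T.card ≤ (k + 1) ^ 2 * 3 ^ k * (n + 1) ^ k := by
    have h2 := two_mul_card_image_le hsing
    rw [Fintype.card_sum, Fintype.card_fin] at h2
    have hb := card_le_of_pattern T pairStep (fun x => (vtx x.1, vtx x.2)) Finset.univ (n + 1)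
      rep sgn (fun _ _ => Finset.mem_univ _)
      (fun x hx => by
        have hx' := Finset.mem_product.1 (hT hx)
        exact natAbs_pairStep_le (Finset.mem_product.2
          ⟨(Finset.mem_sdiff.1 hx'.1).1, (Finset.mem_sdiff.1 hx'.2).1⟩))
      (fun x hx y hy h h' => by
        have hx' := Finset.mem_product.1 (hT hx)
        have hy' := Finset.mem_product.1 (hT hy)
        obtain ⟨h1, h2⟩ := Prod.mk.inj h
        refine pair_ext (vtx x.1) (vtx x.2) ?_ ?_ h'
        · rw [hvtx _ hx'.1, h1, hvtx _ hy'.1]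
        · rw [hvtx _ hx'.2, h2, hvtx _ hy'.2])
      (fun x hx => (hpat x hx).1)
    refine hb.trans ?_
    rw [Finset.card_univ, Fintype.card_prod, Fintype.card_fin, ← sq, mul_assoc]
    refine Nat.mul_le_mul_left _
      ((Nat.pow_le_pow_right (n := 2 * (n + 1) + 1) (by omega) (by omega : _ ≤ k)).trans ?_)
    exact two_mul_add_one_pow_le (by omega) le_rfl
  calc ∑ x ∈ T, |∫ ω, walkWeight a x.1 ω * walkWeight a x.2 ω ∂P|
      ≤ ∑ _x ∈ T, C := Finset.sum_le_sum fun x _ => (hC x.1 x.2).2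
    _ = T.card * C := by rw [Finset.sum_const, nsmul_eq_mul]
    _ ≤ ((k + 1) ^ 2 * 3 ^ k * (n + 1) ^ k : ℕ) * C := by gcongr
    _ = _ := by push_cast; ring

end IndependentDiagonals

/-! ### The recursion for the expected moments -/

theorem sum_filter_rep_eq {E : Type} [Fintype E] [DecidableEq E] {rep : E → E} {e e' : E}
    (hne : e' ≠ e) (hrep : rep e' = rep e) (h : ∀ x, rep x = rep e → x = e ∨ x = e')
    (f : E → ℤ) : ∑ x with rep x = rep e, f x = f e + f e' := by
  have : (Finset.univ.filter fun x => rep x = rep e) = {e, e'} := by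
    ext x
    simp only [Finset.mem_filter, Finset.mem_univ, true_and, Finset.mem_insert,
      Finset.mem_singleton]
    refine ⟨h x, ?_⟩
    rintro (rfl | rfl)
    · rfl
    · exact hrep
  rw [this, Finset.sum_pair hne.symm]

/-- The closed walk `p` traverses the same edge at times `0` and `i + 1`, in opposite
directions. -/
def Backtracks {m : ℕ} (i : Fin m) (p : Fin (m + 1 + 1) → ℕ) : Prop :=
  p i.succ.succ = p 0 ∧ p i.succ.castSucc = p (Fin.succ 0)

instance {m : ℕ} (i : Fin m) (p : Fin (m + 1 + 1) → ℕ) : Decidable (Backtracks i p) :=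
  inferInstanceAs (Decidable (_ ∧ _))

/-- The edges strictly between the times `0` and `i + 1`. -/
def innerEdges {m : ℕ} (i : Fin m) : Finset (Fin (m + 1)) :=
  Finset.univ.filter fun e => 1 ≤ (e : ℕ) ∧ (e : ℕ) < i + 1

/-- The edges after the time `i + 1`. -/
def outerEdges {m : ℕ} (i : Fin m) : Finset (Fin (m + 1)) :=
  Finset.univ.filter fun e => (i : ℕ) + 2 ≤ e

theorem mem_innerEdges {m : ℕ} {i : Fin m} {e : Fin (m + 1)} :
    e ∈ innerEdges i ↔ 1 ≤ (e : ℕ) ∧ (e : ℕ) < i + 1 := by simp [innerEdges]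

theorem mem_outerEdges {m : ℕ} {i : Fin m} {e : Fin (m + 1)} :
    e ∈ outerEdges i ↔ (i : ℕ) + 2 ≤ e := by simp [outerEdges]

def innerWalk {m : ℕ} (i : Fin m) (p : Fin (m + 1 + 1) → ℕ) : Fin ((i : ℕ) + 1) → ℕ :=
  fun l => p ⟨l + 1, by omega⟩

def outerWalk {m : ℕ} (i : Fin m) (p : Fin (m + 1 + 1) → ℕ) : Fin (m - 1 - i + 1) → ℕ :=
  fun l => p ⟨l + i + 2, by omega⟩

def glueWalks {m : ℕ} (i : Fin m) (q : Fin ((i : ℕ) + 1) → ℕ) (q' : Fin (m - 1 - i + 1) → ℕ) :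
    Fin (m + 1 + 1) → ℕ := fun v =>
  if (v : ℕ) = 0 then q' 0
  else if h : (v : ℕ) ≤ i + 1 then q ⟨v - 1, by omega⟩ else q' ⟨v - i - 2, by omega⟩

theorem glueWalks_zero {m : ℕ} (i : Fin m) (q : Fin ((i : ℕ) + 1) → ℕ)
    (q' : Fin (m - 1 - i + 1) → ℕ) : glueWalks i q q' 0 = q' 0 := rfl

theorem glueWalks_inner {m : ℕ} (i : Fin m) (q : Fin ((i : ℕ) + 1) → ℕ)
    (q' : Fin (m - 1 - i + 1) → ℕ) (v : Fin (m + 1 + 1)) (l : Fin ((i : ℕ) + 1))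
    (h : (v : ℕ) = l + 1) : glueWalks i q q' v = q l := by
  unfold glueWalks
  rw [if_neg (by omega), dif_pos (by omega)]
  exact congrArg q (Fin.ext (by dsimp only; omega))

theorem glueWalks_outer {m : ℕ} (i : Fin m) (q : Fin ((i : ℕ) + 1) → ℕ)
    (q' : Fin (m - 1 - i + 1) → ℕ) (v : Fin (m + 1 + 1)) (l : Fin (m - 1 - i + 1))
    (h : (v : ℕ) = l + i + 2) : glueWalks i q q' v = q' l := by
  unfold glueWalks
  rw [if_neg (by omega), dif_neg (by omega)]
  exact congrArg q' (Fin.ext (by dsimp only; omega))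

theorem prod_innerEdges {M : Type*} [CommMonoid M] {m : ℕ} (i : Fin m) (f : ℕ → ℕ → M)
    (p : Fin (m + 1 + 1) → ℕ) :
    ∏ e ∈ innerEdges i, f (p e.castSucc) (p e.succ) =
      ∏ e : Fin i, f (innerWalk i p e.castSucc) (innerWalk i p e.succ) := by
  symm
  refine Finset.prod_bij (fun l _ => (⟨l + 1, by omega⟩ : Fin (m + 1))) ?_ ?_ ?_ ?_
  · intro l _
    rw [mem_innerEdges]
    dsimp only
    omega
  · intro l _ l' _ h
    simpa [Fin.ext_iff] using h
  · intro e he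
    rw [mem_innerEdges] at he
    refine ⟨⟨e - 1, by omega⟩, Finset.mem_univ _, ?_⟩
    ext
    dsimp only
    omega
  · intro l _
    rfl

theorem prod_outerEdges {M : Type*} [CommMonoid M] {m : ℕ} (i : Fin m) (f : ℕ → ℕ → M)
    (p : Fin (m + 1 + 1) → ℕ) :
    ∏ e ∈ outerEdges i, f (p e.castSucc) (p e.succ) =
      ∏ e : Fin (m - 1 - i), f (outerWalk i p e.castSucc) (outerWalk i p e.succ) := by
  symm
  refine Finset.prod_bij (fun l _ => (⟨l + i + 2, by omega⟩ : Fin (m + 1))) ?_ ?_ ?_ ?_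
  · intro l _
    rw [mem_outerEdges]
    dsimp only
    omega
  · intro l _ l' _ h
    simpa [Fin.ext_iff] using h
  · intro e he
    rw [mem_outerEdges] at he
    refine ⟨⟨e - i - 2, by omega⟩, Finset.mem_univ _, ?_⟩
    ext
    dsimp only
    omega
  · intro l _
    simp only [outerWalk]
    congr 2
    ext
    simp
    omega

theorem sum_backtracks {m n : ℕ} (i : Fin m) (f : (Fin ((i : ℕ) + 1) → ℕ) → ℝ)
    (g : (Fin (m - 1 - i + 1) → ℕ) → ℝ) :
    ∑ p ∈ closedWalks (m + 1) n,
      (if Backtracks i p then f (innerWalk i p) * g (outerWalk i p) else 0) =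
      (∑ q ∈ closedWalks i n, f q) * ∑ q ∈ closedWalks (m - 1 - i) n, g q := by
  rw [← Finset.sum_filter, Finset.sum_mul_sum, ← Finset.sum_product']
  have hi := i.2
  refine Finset.sum_nbij' (fun p => (innerWalk i p, outerWalk i p)) (fun q => glueWalks i q.1 q.2)
    ?_ ?_ ?_ ?_ ?_
  · intro p hp
    rw [Finset.mem_filter, mem_closedWalks] at hp
    obtain ⟨⟨hp1, hp2⟩, hb1, hb2⟩ := hp
    rw [Finset.mem_product, mem_closedWalks, mem_closedWalks]
    refine ⟨⟨fun v => hp1 _, ?_⟩, ⟨fun v => hp1 _, ?_⟩⟩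
    · exact hb2.symm
    · rw [hp2] at hb1
      have h1 : outerWalk i p 0 = p i.succ.succ := by
        simp only [outerWalk]
        congr 1
        ext
        simp
      have h2 : outerWalk i p (Fin.last _) = p (Fin.last _) := by
        simp only [outerWalk]
        congr 1
        ext
        simp
        omega
      dsimp only
      rw [h1, h2, hb1]
  · intro q hq
    rw [Finset.mem_product, mem_closedWalks, mem_closedWalks] at hq
    obtain ⟨⟨hq1, hq2⟩, hq3, hq4⟩ := hq
    rw [Finset.mem_filter, mem_closedWalks]
    refine ⟨⟨fun v => ?_, ?_⟩, ?_, ?_⟩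
    · unfold glueWalks
      split_ifs
      exacts [hq3 _, hq1 _, hq3 _]
    · rw [glueWalks_zero, hq4, glueWalks_outer i q.1 q.2 _ (Fin.last _)]
      simp only [Fin.val_last]
      omega
    · rw [glueWalks_zero, glueWalks_outer i q.1 q.2 _ 0]
      simp
    · rw [glueWalks_inner i q.1 q.2 _ (Fin.last _) (by simp),
        glueWalks_inner i q.1 q.2 _ 0 (by simp), hq2]
  · intro p hp
    rw [Finset.mem_filter, mem_closedWalks] at hp
    obtain ⟨⟨hp1, hp2⟩, hb1, hb2⟩ := hp
    funext v
    rcases Nat.eq_zero_or_pos (v : ℕ) with h0 | h0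
    · have hv : v = 0 := Fin.ext h0
      rw [hv, glueWalks_zero, ← hb1]
      exact congrArg p (Fin.ext (by simp))
    · by_cases h1 : (v : ℕ) ≤ i + 1
      · rw [glueWalks_inner i _ _ v ⟨v - 1, by omega⟩ (by dsimp only; omega)]
        exact congrArg p (Fin.ext (by dsimp only; omega))
      · rw [glueWalks_outer i _ _ v ⟨v - i - 2, by omega⟩ (by dsimp only; omega)]
        exact congrArg p (Fin.ext (by dsimp only; omega))
  · intro q hq
    have h1 : innerWalk i (glueWalks i q.1 q.2) = q.1 :=
      funext fun v => glueWalks_inner i q.1 q.2 _ v rfl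
    have h2 : outerWalk i (glueWalks i q.1 q.2) = q.2 :=
      funext fun v => glueWalks_outer i q.1 q.2 _ v rfl
    exact Prod.ext h1 h2
  · intro p _
    rfl

/-- The joint moment of the entries along the edges in `A` of the walk `p`. -/
noncomputable def edgeMoment {Ω : Type*} [MeasurableSpace Ω] (P : Measure Ω)
    (a : ℕ → ℕ → Ω → ℝ) {k : ℕ} (p : Fin (k + 1) → ℕ) (A : Finset (Fin k)) : ℝ :=
  ∫ ω, ∏ e ∈ A, entry a (p e.castSucc) (p e.succ) ω ∂P

/-- The difference between the moment of a closed walk and the product of the moments of its two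
parts, for all ways of matching its first edge. -/
noncomputable def splitDefect {Ω : Type*} [MeasurableSpace Ω] (P : Measure Ω)
    (a : ℕ → ℕ → Ω → ℝ) {m : ℕ} (p : Fin (m + 1 + 1) → ℕ) : ℝ :=
  edgeMoment P a p Finset.univ - ∑ i : Fin m, if Backtracks i p then
    edgeMoment P a p (innerEdges i) * edgeMoment P a p (outerEdges i) else 0

theorem Backtracks.step_eq {m : ℕ} {i : Fin m} {p : Fin (m + 1 + 1) → ℕ} (h : Backtracks i p) :
    step p i.succ = - step p 0 := by
  unfold step
  rw [h.1, h.2]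
  simp

theorem sum_step_inner {m : ℕ} (i : Fin m) (p : Fin (m + 1 + 1) → ℕ) :
    ∑ e : Fin (m + 1), (if 1 ≤ (e : ℕ) ∧ (e : ℕ) < i + 1 then 1 else 0) * step p e =
      (p i.succ.castSucc : ℤ) - p (Fin.succ 0) := by
  have h := sum_step_interval p (Fin.succ 0) i.succ.castSucc
    (by rw [Fin.le_def]; simp)
  simpa using h

namespace IndependentDiagonals

variable {Ω : Type*} [MeasurableSpace Ω] {P : Measure Ω}
  {a : ℕ → ℕ → Ω → ℝ} {Cov : ℕ → ℝ}

theorem edgeMoment_eq_zero (H : IndependentDiagonals P a Cov) {k : ℕ} (p : Fin (k + 1) → ℕ)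
    (A : Finset (Fin k)) (e : Fin k) (heA : e ∈ A)
    (he : ∀ e', e' ≠ e → (step p e').natAbs ≠ (step p e).natAbs) : edgeMoment P a p A = 0 :=
  H.integral_prod_eq_zero A _ _ e heA fun e' _ hne => he e' hne

theorem edgeMoment_union (H : IndependentDiagonals P a Cov) {k : ℕ} (p : Fin (k + 1) → ℕ)
    (A B : Finset (Fin k)) (h : ∀ e ∈ A, ∀ e' ∈ B, (step p e).natAbs ≠ (step p e').natAbs) :
    edgeMoment P a p (A ∪ B) = edgeMoment P a p A * edgeMoment P a p B := by
  have hd : Disjoint A B := Finset.disjoint_left.2 fun e he he' => h e he e he' rfl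
  simp only [edgeMoment, Finset.prod_union hd]
  exact H.integral_prod_mul_prod A B _ _ h

theorem splitDefect_eq_zero_of_singleton (H : IndependentDiagonals P a Cov) {m : ℕ}
    (p : Fin (m + 1 + 1) → ℕ) (e : Fin (m + 1))
    (he : ∀ e', e' ≠ e → (step p e').natAbs ≠ (step p e).natAbs) : splitDefect P a p = 0 := by
  rw [splitDefect, H.edgeMoment_eq_zero p _ e (Finset.mem_univ e) he, Finset.sum_eq_zero,
    sub_zero]
  intro i _
  split_ifs with hi
  · have habs : (step p i.succ).natAbs = (step p 0).natAbs := by rw [hi.step_eq, Int.natAbs_neg]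
    have hne0 : i.succ ≠ 0 := Fin.succ_ne_zero i
    have h0 : e ≠ 0 := by
      rintro rfl
      exact he _ hne0 habs
    have h1 : e ≠ i.succ := by
      rintro rfl
      exact he _ hne0.symm habs.symm
    have h0' : (e : ℕ) ≠ 0 := fun h => h0 (Fin.ext h)
    have h1' : (e : ℕ) ≠ i + 1 := fun h => h1 (Fin.ext (by simpa using h))
    by_cases hlt : (e : ℕ) < i + 1
    · rw [H.edgeMoment_eq_zero p _ e (mem_innerEdges.2 ⟨by omega, hlt⟩) he, zero_mul]
    · rw [H.edgeMoment_eq_zero p (outerEdges i) e (mem_outerEdges.2 (by omega)) he, mul_zero]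
  · rfl

theorem union_inner_outer {m : ℕ} (i : Fin m) :
    (Finset.univ : Finset (Fin (m + 1))) = {0, i.succ} ∪ (innerEdges i ∪ outerEdges i) := by
  ext e
  simp only [Finset.mem_univ, Finset.mem_union, Finset.mem_insert, Finset.mem_singleton,
    mem_innerEdges, mem_outerEdges, Fin.ext_iff, Fin.val_zero, Fin.val_succ, true_iff]
  omega

/-- If the first edge is matched with the edge at time `i + 1` only, in opposite direction, then
its contribution is a covariance. -/
theorem splitDefect_eq (H : IndependentDiagonals P a Cov) {m : ℕ} (p : Fin (m + 1 + 1) → ℕ)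
    (i : Fin m) (hi : step p i.succ = - step p 0)
    (hfib : ∀ e, (step p e).natAbs = (step p 0).natAbs → e = 0 ∨ e = i.succ) :
    splitDefect P a p = Cov ((p i.succ.castSucc : ℤ) - p (Fin.succ 0)).natAbs *
        edgeMoment P a p (innerEdges i ∪ outerEdges i) -
      if (p i.succ.castSucc : ℤ) - p (Fin.succ 0) = 0 then
        edgeMoment P a p (innerEdges i) * edgeMoment P a p (outerEdges i) else 0 := by
  have hne0 : (0 : Fin (m + 1)) ≠ i.succ := (Fin.succ_ne_zero i).symm
  have habs : (step p i.succ).natAbs = (step p 0).natAbs := by rw [hi, Int.natAbs_neg]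
  have hi' := hi
  simp only [step, Fin.castSucc_zero] at hi'
  have hB : Backtracks i p ↔ (p i.succ.castSucc : ℤ) - p (Fin.succ 0) = 0 := by
    unfold Backtracks
    constructor
    · rintro ⟨-, h⟩
      rw [h, sub_self]
    · intro h
      constructor <;> omega
  have hsum : (∑ i' : Fin m, if Backtracks i' p then
      edgeMoment P a p (innerEdges i') * edgeMoment P a p (outerEdges i') else 0) =
      if (p i.succ.castSucc : ℤ) - p (Fin.succ 0) = 0 then
        edgeMoment P a p (innerEdges i) * edgeMoment P a p (outerEdges i) else 0 := by
    rw [Finset.sum_eq_single i]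
    · simp only [hB]
    · intro i' _ hne
      rw [if_neg]
      intro hb
      have h1 := hb.step_eq
      rcases hfib i'.succ (by rw [h1, Int.natAbs_neg]) with h | h
      · exact Fin.succ_ne_zero _ h
      · exact hne (Fin.succ_injective _ h)
    · intro h
      exact absurd (Finset.mem_univ i) h
  have h2 : edgeMoment P a p {0, i.succ} =
      Cov ((p i.succ.castSucc : ℤ) - p (Fin.succ 0)).natAbs := by
    simp only [edgeMoment, Finset.prod_pair hne0]
    rw [entry_comm a (p i.succ.castSucc)]
    exact H.integral_entry_mul_entry_shift _ _ _ _ _ (by simp only [Fin.castSucc_zero]; omega)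
      (by omega)
  rw [splitDefect, hsum, union_inner_outer i, H.edgeMoment_union, h2]
  intro e he e' he' h
  have he0 : (step p e).natAbs = (step p 0).natAbs := by
    rw [Finset.mem_insert, Finset.mem_singleton] at he
    rcases he with rfl | rfl
    · rfl
    · exact habs
  rw [Finset.mem_union, mem_innerEdges, mem_outerEdges] at he'
  rcases hfib e' (h ▸ he0) with rfl | rfl
  · simp at he'
  · simp at he'

theorem summable_weight (H : IndependentDiagonals P a Cov) :
    Summable fun z : ℤ => |Cov z.natAbs| + if z = 0 then 1 else 0 := by
  refine Summable.add (Summable.of_nat_of_neg ?_ ?_) ?_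
  · simpa using H.summable
  · simpa using H.summable
  · exact summable_of_ne_finset_zero (s := {0}) fun z hz => by simpa using hz

variable [IsProbabilityMeasure P]

theorem exists_edgeMoment_bound (H : IndependentDiagonals P a Cov) (k : ℕ) :
    ∃ C : ℝ, 1 ≤ C ∧ ∀ (p : Fin (k + 1) → ℕ) (A : Finset (Fin k)), |edgeMoment P a p A| ≤ C := by
  obtain ⟨C, hC1, hC⟩ := H.exists_prod_bound k
  exact ⟨C, hC1, fun p A => (hC (Fin k) A _ _ (by simpa using A.card_le_univ)).2⟩

theorem sum_splitDefect (H : IndependentDiagonals P a Cov) (m n : ℕ) :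
    ∑ p ∈ closedWalks (m + 1) n, splitDefect P a p =
      ∫ ω, walkSum a (m + 1) n ω ∂P -
        ∑ i : Fin m, (∫ ω, walkSum a i n ω ∂P) * ∫ ω, walkSum a (m - 1 - i) n ω ∂P := by
  have hw : ∀ k, ∫ ω, walkSum a k n ω ∂P = ∑ p ∈ closedWalks k n, ∫ ω, walkWeight a p ω ∂P :=
    fun k => integral_finsetSum _ fun p _ => H.integrable_walkWeight p
  simp only [splitDefect, Finset.sum_sub_distrib, hw]
  congr 1
  rw [Finset.sum_comm]
  refine Finset.sum_congr rfl fun i _ => ?_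
  rw [← sum_backtracks]
  refine Finset.sum_congr rfl fun p _ => ?_
  simp only [edgeMoment, walkWeight]
  congr 2
  · refine integral_congr_ae (ae_of_all _ fun ω => ?_)
    exact prod_innerEdges i (fun u v => entry a u v ω) p
  · refine integral_congr_ae (ae_of_all _ fun ω => ?_)
    exact prod_outerEdges i (fun u v => entry a u v ω) p

/-- The expected moments satisfy the recursion of the Catalan numbers up to an error of smaller
order. -/
theorem exists_recursion_bound (H : IndependentDiagonals P a Cov) (m : ℕ) :
    ∃ C : ℝ, 0 ≤ C ∧ ∀ n, 1 ≤ n →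
      |∫ ω, walkSum a (m + 1) n ω ∂P -
        ∑ i : Fin m, (∫ ω, walkSum a i n ω ∂P) * ∫ ω, walkSum a (m - 1 - i) n ω ∂P| ≤
        C * (n : ℝ) ^ ((m + 2) / 2) := by
  obtain ⟨C, hC1, hC⟩ := H.exists_edgeMoment_bound (m + 1)
  have hC0 : 0 ≤ C := by linarith
  let g : ℤ → ℝ := fun z => |Cov z.natAbs| + if z = 0 then 1 else 0
  have hg0 : ∀ z, 0 ≤ g z := fun z => by positivity
  have hg : Summable g := H.summable_weight
  have hG : 0 ≤ ∑' z, g z := tsum_nonneg hg0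
  refine ⟨Fintype.card ((Fin (m + 1) → Fin (m + 1)) × (Fin (m + 1) → ℤˣ)) *
    ((3 ^ (m + 1) : ℕ) * ((C + m * (C * C)) * (1 + ∑' z, g z))), by positivity, fun n hn => ?_⟩
  rw [← H.sum_splitDefect, mul_assoc]
  refine (Finset.abs_sum_le_sum_abs _ _).trans ?_
  refine sum_le_of_pattern _ step _ _ fun rep sgn T hT hpat => ?_
  have hdef : ∀ p : Fin (m + 1 + 1) → ℕ, |splitDefect P a p| ≤ C + m * (C * C) := by
    intro p
    refine (abs_sub _ _).trans (add_le_add (hC p _) ?_)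
    refine (Finset.abs_sum_le_sum_abs _ _).trans ?_
    refine (Finset.sum_le_card_nsmul _ _ (C * C) fun i _ => ?_).trans_eq (by simp)
    split_ifs
    · rw [abs_mul]
      exact mul_le_mul (hC p _) (hC p _) (abs_nonneg _) hC0
    · rw [abs_zero]
      positivity
  have hdef0 : 0 ≤ C + m * (C * C) := by positivity
  have hbase : ∀ p ∈ T, p 0 ∈ Finset.range n := fun p hp =>
    Finset.mem_range.2 ((mem_closedWalks.1 (hT hp)).1 0)
  have hd : ∀ p ∈ T, ∀ e, (step p e).natAbs ≤ n := fun p hp => natAbs_step_le (hT hp)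
  have hinj : ∀ p ∈ T, ∀ q ∈ T, p 0 = q 0 → step p = step q → p = q :=
    fun p _ q _ h h' => walk_ext 0 h h'
  have hpat1 : ∀ p ∈ T, ∀ e, step p e = sgn e * step p (rep e) := fun p hp => (hpat p hp).1
  by_cases hsing : ∀ e, ∃ e', e' ≠ e ∧ rep e' = rep e
  swap
  · push Not at hsing
    obtain ⟨e, he⟩ := hsing
    rw [Finset.sum_eq_zero]
    · positivity
    intro p hp
    rw [H.splitDefect_eq_zero_of_singleton p e
      fun e' hne h => he e' hne (((hpat p hp).2 _ _).1 h), abs_zero]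
  have h2 := two_mul_card_image_le hsing
  rw [Fintype.card_fin] at h2
  set I := (Finset.univ.image rep).card with hI
  -- a bound on the number of walks suffices
  have hcount : ∀ r, r + 1 ≤ (m + 2) / 2 → T.card ≤ (Finset.range n).card * (2 * n + 1) ^ r →
      ∑ p ∈ T, |splitDefect P a p| ≤
        (3 ^ (m + 1) : ℕ) * ((C + m * (C * C)) * (1 + ∑' z, g z)) * (n : ℝ) ^ ((m + 2) / 2) := by
    intro r hr hcard
    have h3 : T.card ≤ 3 ^ (m + 1) * n ^ ((m + 2) / 2) := by
      refine hcard.trans ?_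
      rw [Finset.card_range]
      calc n * (2 * n + 1) ^ r ≤ n * (3 ^ (m + 1) * n ^ r) :=
            Nat.mul_le_mul_left _ (two_mul_add_one_pow_le hn (by omega))
        _ = 3 ^ (m + 1) * n ^ (r + 1) := by ring
        _ ≤ _ := Nat.mul_le_mul_left _ (Nat.pow_le_pow_right hn hr)
    calc ∑ p ∈ T, |splitDefect P a p| ≤ ∑ _p ∈ T, (C + m * (C * C)) :=
          Finset.sum_le_sum fun p _ => hdef p
      _ = T.card * ((C + m * (C * C)) * 1) := by rw [Finset.sum_const, nsmul_eq_mul, mul_one]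
      _ ≤ (3 ^ (m + 1) * n ^ ((m + 2) / 2) : ℕ) * ((C + m * (C * C)) * (1 + ∑' z, g z)) := by
          gcongr
          linarith
      _ = _ := by push_cast; ring
  by_cases hIm : 2 * I = m + 1
  swap
  · exact hcount I (by omega)
      (card_le_of_pattern T step (fun p => p 0) _ n rep sgn hbase hd hinj hpat1)
  by_cases hclose : ∃ B, ∑ e with rep e = B, 1 * (sgn e : ℤ) ≠ 0
  · obtain ⟨B, hB⟩ := hclose
    exact hcount (I - 1) (by omega)
      (card_le_of_relation T step (fun p => p 0) _ n rep sgn hbase hd hinj hpat1 (fun _ => 1) B hB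
        fun p hp => by simpa using sum_step_eq_zero (hT hp))
  push Not at hclose
  obtain ⟨j, hj0, hjrep, hjfib⟩ := exists_partner hsing (by rw [← hI, hIm, Fintype.card_fin]) 0
  obtain ⟨i, rfl⟩ : ∃ i : Fin m, j = i.succ := ⟨j.pred hj0, (Fin.succ_pred j hj0).symm⟩
  have hsgn : (sgn 0 : ℤ) + sgn i.succ = 0 := by
    have := hclose (rep 0)
    rwa [sum_filter_rep_eq hj0 hjrep hjfib, one_mul, one_mul] at this
  have hsplit : ∀ p ∈ T, splitDefect P a p =
      Cov ((p i.succ.castSucc : ℤ) - p (Fin.succ 0)).natAbs *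
        edgeMoment P a p (innerEdges i ∪ outerEdges i) -
      if (p i.succ.castSucc : ℤ) - p (Fin.succ 0) = 0 then
        edgeMoment P a p (innerEdges i) * edgeMoment P a p (outerEdges i) else 0 := by
    intro p hp
    refine H.splitDefect_eq p i ?_ fun e he => hjfib e (((hpat p hp).2 _ _).1 he)
    rw [hpat1 p hp i.succ, hjrep, hpat1 p hp 0]
    linear_combination (step p (rep 0)) * hsgn
  let c : Fin (m + 1) → ℤ := fun e => if 1 ≤ (e : ℕ) ∧ (e : ℕ) < i + 1 then 1 else 0
  have hlag : ∀ p : Fin (m + 1 + 1) → ℕ,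
      (p i.succ.castSucc : ℤ) - p (Fin.succ 0) = ∑ e, c e * step p e :=
    fun p => (sum_step_inner i p).symm
  by_cases hform : ∃ B, ∑ e with rep e = B, c e * (sgn e : ℤ) ≠ 0
  · obtain ⟨B, hB⟩ := hform
    have hw := sum_weight_le T step (fun p => p 0) (Finset.range n) n rep sgn hbase hd hinj hpat1
      c B hB g hg0 hg
    rw [← hI, Finset.card_range] at hw
    have hle : ∀ p ∈ T, |splitDefect P a p| ≤ (C * C) * g (∑ e, c e * step p e) := by
      intro p hp
      rw [hsplit p hp, hlag p]
      refine (abs_sub _ _).trans ?_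
      simp only [g, mul_add]
      refine add_le_add ?_ ?_
      · rw [abs_mul, mul_comm]
        refine mul_le_mul_of_nonneg_right ((hC p _).trans ?_) (abs_nonneg _)
        nlinarith
      · split_ifs
        · rw [abs_mul, mul_one]
          exact mul_le_mul (hC p _) (hC p _) (abs_nonneg _) hC0
        · simp
    have hm1 : (1 : ℝ) ≤ m := by exact_mod_cast i.pos
    have hCC : C * C ≤ C + m * (C * C) := by nlinarith [mul_nonneg hC0 hC0]
    have hnat : n * (2 * n + 1) ^ (I - 1) ≤ 3 ^ (m + 1) * n ^ ((m + 2) / 2) := by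
      calc n * (2 * n + 1) ^ (I - 1) ≤ n * (3 ^ (m + 1) * n ^ (I - 1)) :=
            Nat.mul_le_mul_left _ (two_mul_add_one_pow_le hn (by omega))
        _ = 3 ^ (m + 1) * n ^ (I - 1 + 1) := by ring
        _ ≤ _ := Nat.mul_le_mul_left _ (Nat.pow_le_pow_right hn (by omega))
    calc ∑ p ∈ T, |splitDefect P a p| ≤ ∑ p ∈ T, (C * C) * g (∑ e, c e * step p e) :=
          Finset.sum_le_sum hle
      _ = (C * C) * ∑ p ∈ T, g (∑ e, c e * step p e) := by rw [Finset.mul_sum]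
      _ ≤ (C + m * (C * C)) *
          ((3 ^ (m + 1) * n ^ ((m + 2) / 2) : ℕ) * (1 + ∑' z, g z)) := by
          refine mul_le_mul hCC (hw.trans ?_) (Finset.sum_nonneg fun p _ => hg0 _) hdef0
          refine mul_le_mul (by exact_mod_cast hnat) (by linarith) hG (by positivity)
      _ = _ := by push_cast; ring
  push Not at hform
  rw [Finset.sum_eq_zero]
  · positivity
  intro p hp
  have hL : (p i.succ.castSucc : ℤ) - p (Fin.succ 0) = 0 := by
    rw [hlag, sum_mul_eq_sum_image rep sgn (hpat1 p hp) c]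
    exact Finset.sum_eq_zero fun b _ => by rw [hform b, zero_mul]
  rw [hsplit p hp, hL, if_pos rfl, Int.natAbs_zero, H.cov_zero, one_mul, H.edgeMoment_union,
    sub_self, abs_zero]
  intro e he e' he' habs
  have hrep : rep e' = rep e := (((hpat p hp).2 _ _).1 habs).symm
  rw [mem_innerEdges] at he
  rw [mem_outerEdges] at he'
  have hne : e' ≠ e := by
    rintro rfl
    omega
  obtain ⟨e₂, hne₂, hrep₂, hfib₂⟩ := exists_partner hsing (by rw [← hI, hIm, Fintype.card_fin]) e
  have he₂ : e' = e₂ := (hfib₂ e' hrep).resolve_left hne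
  have := hform (rep e)
  rw [sum_filter_rep_eq hne₂ hrep₂ hfib₂, ← he₂] at this
  simp only [c] at this
  rw [if_pos he, if_neg (by omega), one_mul, zero_mul, add_zero] at this
  exact (sgn e).ne_zero this

end IndependentDiagonals

/-! ### Convergence of the moments -/

/-- The moments of the semicircle distribution. -/
def semicircleMoment (k : ℕ) : ℝ := if Even k then (catalan (k / 2) : ℝ) else 0

theorem semicircleMoment_even (j : ℕ) : semicircleMoment (2 * j) = catalan j := by
  simp [semicircleMoment]

theorem semicircleMoment_odd {k : ℕ} (hk : Odd k) : semicircleMoment k = 0 := by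
  simp [semicircleMoment, hk]

theorem sum_range_two_mul_add_one {f : ℕ → ℝ} (hf : ∀ t, f (2 * t + 1) = 0) (j : ℕ) :
    ∑ i ∈ Finset.range (2 * j + 1), f i = ∑ t ∈ Finset.range (j + 1), f (2 * t) := by
  induction j with
  | zero => simp
  | succ j ih =>
    rw [show 2 * (j + 1) + 1 = 2 * j + 1 + 1 + 1 by ring, Finset.sum_range_succ,
      Finset.sum_range_succ, ih, Finset.sum_range_succ _ (j + 1), hf, add_zero,
      show 2 * j + 1 + 1 = 2 * (j + 1) by ring]

theorem semicircleMoment_succ (k : ℕ) :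
    semicircleMoment (k + 1) = ∑ i : Fin k, semicircleMoment i * semicircleMoment (k - 1 - i) := by
  rcases Nat.even_or_odd' k with ⟨j, rfl | rfl⟩
  · rw [semicircleMoment_odd ⟨j, rfl⟩, eq_comm]
    refine Finset.sum_eq_zero fun i _ => ?_
    have := i.2
    rcases Nat.even_or_odd i with hi | hi
    · rw [semicircleMoment_odd (k := 2 * j - 1 - i), mul_zero]
      obtain ⟨t, ht⟩ := hi
      exact ⟨j - 1 - t, by omega⟩
    · rw [semicircleMoment_odd hi, zero_mul]
  · rw [show 2 * j + 1 + 1 = 2 * (j + 1) by ring, semicircleMoment_even, catalan_succ,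
      Fin.sum_univ_eq_sum_range
        (fun i => semicircleMoment i * semicircleMoment (2 * j + 1 - 1 - i)),
      sum_range_two_mul_add_one (fun t => by rw [semicircleMoment_odd ⟨t, rfl⟩, zero_mul]),
      Fin.sum_univ_eq_sum_range (fun i => catalan i * catalan (j - i))]
    rw [Nat.cast_sum]
    refine Finset.sum_congr rfl fun t _ => ?_
    rw [Nat.cast_mul, show 2 * j + 1 - 1 - 2 * t = 2 * (j - t) by omega, semicircleMoment_even,
      semicircleMoment_even]

theorem walkSum_zero {Ω : Type*} (a : ℕ → ℕ → Ω → ℝ) (n : ℕ) (ω : Ω) : walkSum a 0 n ω = n := by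
  have : closedWalks 0 n = Fintype.piFinset fun _ => Finset.range n :=
    Finset.filter_true_of_mem fun p _ => rfl
  simp [walkSum, walkWeight, this]

/-- The `k`-th moment of the empirical eigenvalue distribution. -/
noncomputable def empiricalMoment {Ω : Type*} (a : ℕ → ℕ → Ω → ℝ) (k n : ℕ) (ω : Ω) : ℝ :=
  walkSum a k n ω / √(n : ℝ) ^ (k + 2)

theorem ae_tendsto_zero_of_summable_sq {Ω : Type*} [MeasurableSpace Ω] {P : Measure Ω}
    (X : ℕ → Ω → ℝ) (hX : ∀ m, Integrable (fun ω => X m ω ^ 2) P) (b : ℕ → ℝ)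
    (hb : Summable b) (h : ∀ m, ∫ ω, X m ω ^ 2 ∂P ≤ b m) :
    ∀ᵐ ω ∂P, Tendsto (fun m => X m ω) atTop (𝓝 0) := by
  have hb0 : ∀ m, 0 ≤ b m := fun m => (integral_nonneg fun ω => sq_nonneg _).trans (h m)
  have hlt : ∫⁻ ω, ∑' m, ENNReal.ofReal (X m ω ^ 2) ∂P ≠ ∞ := by
    rw [lintegral_tsum fun m => (hX m).1.aemeasurable.ennreal_ofReal]
    refine ne_top_of_le_ne_top hb.tsum_ofReal_ne_top (ENNReal.tsum_le_tsum fun m => ?_)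
    rw [← ofReal_integral_eq_lintegral_ofReal (hX m) (ae_of_all _ fun ω => sq_nonneg _)]
    exact ENNReal.ofReal_le_ofReal (h m)
  have hae := ae_lt_top' (AEMeasurable.tsum
    fun m => (hX m).1.aemeasurable.ennreal_ofReal) hlt
  filter_upwards [hae] with ω hω
  have h1 : Tendsto (fun m => (ENNReal.ofReal (X m ω ^ 2)).toReal) atTop (𝓝 0) :=
    (ENNReal.summable_toReal hω.ne).tendsto_atTop_zero
  simp only [ENNReal.toReal_ofReal (sq_nonneg _)] at h1
  have h2 := h1.sqrt
  simp only [Real.sqrt_sq_eq_abs, Real.sqrt_zero] at h2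
  exact (tendsto_zero_iff_abs_tendsto_zero _).2 h2

theorem summable_const_div_sq (C : ℝ) : Summable fun m : ℕ => C / ((m : ℝ) + 1) ^ 2 := by
  have h : Summable fun m : ℕ => 1 / ((m : ℝ)) ^ 2 :=
    Real.summable_one_div_nat_pow.2 (by norm_num)
  have h1 := ((summable_nat_add_iff 1).2 h).mul_left C
  simpa [div_eq_mul_inv] using h1

theorem tendsto_natSqrt_div_sqrt :
    Tendsto (fun n : ℕ => (Nat.sqrt n : ℝ) / √(n : ℝ)) atTop (𝓝 1) := by
  have hs : Tendsto (fun n : ℕ => √(n : ℝ)) atTop atTop :=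
    Real.tendsto_sqrt_atTop.comp tendsto_natCast_atTop_atTop
  have hlow : Tendsto (fun n : ℕ => 1 - 1 / √(n : ℝ)) atTop (𝓝 1) := by
    have := (tendsto_const_nhds (x := (1 : ℝ))).div_atTop hs
    simpa using tendsto_const_nhds.sub this
  refine tendsto_of_tendsto_of_tendsto_of_le_of_le' hlow tendsto_const_nhds ?_ ?_
  · filter_upwards [eventually_ge_atTop 1] with n hn
    have h0 : 0 < √(n : ℝ) := Real.sqrt_pos.2 (by exact_mod_cast hn)
    rw [le_div_iff₀ h0, sub_mul, one_mul, one_div_mul_cancel h0.ne']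
    have h1 : √(n : ℝ) ≤ Nat.sqrt n + 1 := by
      rw [Real.sqrt_le_left (by positivity)]
      have := (Nat.lt_succ_sqrt' n).le
      exact_mod_cast this
    linarith
  · filter_upwards [eventually_ge_atTop 1] with n hn
    have h0 : 0 < √(n : ℝ) := Real.sqrt_pos.2 (by exact_mod_cast hn)
    rw [div_le_one h0]
    exact Real.nat_sqrt_le_real_sqrt

namespace IndependentDiagonals

variable {Ω : Type*} [MeasurableSpace Ω] {P : Measure Ω} [IsProbabilityMeasure P]
  {a : ℕ → ℕ → Ω → ℝ} {Cov : ℕ → ℝ}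

theorem tendsto_mean_walkSum (H : IndependentDiagonals P a Cov) (k : ℕ) :
    Tendsto (fun n : ℕ => (∫ ω, walkSum a k n ω ∂P) / √(n : ℝ) ^ (k + 2)) atTop
      (𝓝 (semicircleMoment k)) := by
  induction k using Nat.strong_induction_on with
  | _ k ih =>
  rcases k with _ | k
  · have : semicircleMoment 0 = 1 := by simp [semicircleMoment]
    rw [this]
    refine tendsto_const_nhds.congr' ?_
    filter_upwards [eventually_ge_atTop 1] with n hn
    have hn' : (n : ℝ) ≠ 0 := by positivity
    simp only [walkSum_zero, integral_const, probReal_univ, one_smul, zero_add]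
    rw [Real.sq_sqrt (by positivity), div_self hn']
  · obtain ⟨C, hC0, hC⟩ := H.exists_recursion_bound k
    rw [semicircleMoment_succ]
    have hsum : Tendsto (fun n : ℕ => ∑ i : Fin k,
        ((∫ ω, walkSum a i n ω ∂P) / √(n : ℝ) ^ ((i : ℕ) + 2)) *
          ((∫ ω, walkSum a (k - 1 - i) n ω ∂P) / √(n : ℝ) ^ (k - 1 - i + 2))) atTop
        (𝓝 (∑ i : Fin k, semicircleMoment i * semicircleMoment (k - 1 - i))) :=
      tendsto_finsetSum _ fun i _ => (ih i (by omega)).mul (ih (k - 1 - i) (by omega))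
    have hs : Tendsto (fun n : ℕ => √(n : ℝ)) atTop atTop :=
      Real.tendsto_sqrt_atTop.comp tendsto_natCast_atTop_atTop
    have hdiff : Tendsto (fun n : ℕ => (∫ ω, walkSum a (k + 1) n ω ∂P) / √(n : ℝ) ^ (k + 1 + 2) -
        ∑ i : Fin k, ((∫ ω, walkSum a i n ω ∂P) / √(n : ℝ) ^ ((i : ℕ) + 2)) *
          ((∫ ω, walkSum a (k - 1 - i) n ω ∂P) / √(n : ℝ) ^ (k - 1 - i + 2))) atTop (𝓝 0) := by
      refine squeeze_zero_norm' ?_ ((tendsto_const_nhds (x := C)).div_atTop hs)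
      filter_upwards [eventually_ge_atTop 1] with n hn
      have hn1 : (1 : ℝ) ≤ n := by exact_mod_cast hn
      have h1 : 1 ≤ √(n : ℝ) := Real.one_le_sqrt.2 hn1
      have h0 : 0 < √(n : ℝ) := by linarith
      have heq : ∑ i : Fin k, ((∫ ω, walkSum a i n ω ∂P) / √(n : ℝ) ^ ((i : ℕ) + 2)) *
          ((∫ ω, walkSum a (k - 1 - i) n ω ∂P) / √(n : ℝ) ^ (k - 1 - i + 2)) =
          (∑ i : Fin k, (∫ ω, walkSum a i n ω ∂P) * ∫ ω, walkSum a (k - 1 - i) n ω ∂P) /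
            √(n : ℝ) ^ (k + 1 + 2) := by
        rw [Finset.sum_div]
        refine Finset.sum_congr rfl fun i _ => ?_
        rw [div_mul_div_comm, ← pow_add]
        congr 2
        omega
      rw [heq, ← sub_div, Real.norm_eq_abs, abs_div, abs_of_pos (pow_pos h0 (k + 1 + 2)),
        div_le_div_iff₀ (by positivity) h0]
      have hpow : (n : ℝ) ^ ((k + 2) / 2) ≤ √(n : ℝ) ^ (k + 2) := by
        rw [← Real.sq_sqrt (by positivity : (0 : ℝ) ≤ n), ← pow_mul, Real.sq_sqrt (by positivity)]
        exact pow_le_pow_right₀ h1 (Nat.mul_div_le _ _)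
      calc _ ≤ C * (n : ℝ) ^ ((k + 2) / 2) * √(n : ℝ) := by
            gcongr
            exact hC n hn
        _ ≤ C * √(n : ℝ) ^ (k + 2) * √(n : ℝ) := by gcongr
        _ = C * √(n : ℝ) ^ (k + 1 + 2) := by ring
    simpa using hdiff.add hsum

theorem ae_tendsto_deviation (H : IndependentDiagonals P a Cov) (k : ℕ) :
    ∀ᵐ ω ∂P, Tendsto (fun m : ℕ => (walkSum a k ((m + 1) ^ 2) ω -
      ∫ ω, walkSum a k ((m + 1) ^ 2) ω ∂P) / ((m : ℝ) + 1) ^ (k + 2)) atTop (𝓝 0) := by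
  obtain ⟨C, hC0, hC⟩ := H.exists_variance_bound k
  refine ae_tendsto_zero_of_summable_sq _ (fun m => ?_) _ (summable_const_div_sq C) fun m => ?_
  · simp only [div_pow]
    exact (H.integrable_walkSum_sub_sq k _ _).div_const _
  · simp only [div_pow]
    rw [integral_div, div_le_div_iff₀ (by positivity) (by positivity)]
    have h := hC ((m + 1) ^ 2) (Nat.one_le_pow _ _ (by omega))
    calc _ ≤ C * (((m + 1) ^ 2 : ℕ) : ℝ) ^ (k + 1) * ((m : ℝ) + 1) ^ 2 := by gcongr
      _ = _ := by
          rw [Nat.cast_pow, Nat.cast_succ, ← pow_mul, ← pow_mul, mul_assoc, ← pow_add]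
          ring_nf

theorem integrable_increment_sq (H : IndependentDiagonals P a Cov) (k l : ℕ) :
    Integrable (fun ω => (walkSum a k (l + 1) ω - walkSum a k l ω) ^ 2) P := by
  have h : ∀ ω, walkSum a k (l + 1) ω - walkSum a k l ω =
      ∑ p ∈ closedWalks k (l + 1) \ closedWalks k l, walkWeight a p ω := by
    intro ω
    rw [walkSum, walkSum, sub_eq_iff_eq_add,
      Finset.sum_sdiff (closedWalks_mono k (Nat.le_succ l))]
  simp only [h]
  exact H.integrable_sum_sq _

theorem ae_tendsto_oscillation (H : IndependentDiagonals P a Cov) (k : ℕ) :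
    ∀ᵐ ω ∂P, Tendsto (fun m : ℕ =>
      (∑ l ∈ Finset.Ico ((m + 1) ^ 2) ((m + 2) ^ 2),
        |walkSum a k (l + 1) ω - walkSum a k l ω|) / ((m : ℝ) + 1) ^ (k + 2)) atTop (𝓝 0) := by
  obtain ⟨C, hC0, hC⟩ := H.exists_increment_bound k
  have hsq : ∀ m ω, (∑ l ∈ Finset.Ico ((m + 1) ^ 2) ((m + 2) ^ 2),
      |walkSum a k (l + 1) ω - walkSum a k l ω|) ^ 2 ≤
      (Finset.Ico ((m + 1) ^ 2) ((m + 2) ^ 2)).card *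
        ∑ l ∈ Finset.Ico ((m + 1) ^ 2) ((m + 2) ^ 2),
          (walkSum a k (l + 1) ω - walkSum a k l ω) ^ 2 := fun m ω => by
    refine sq_sum_le_card_mul_sum_sq.trans_eq ?_
    simp only [sq_abs]
  have hint : ∀ m, Integrable (fun ω => (((Finset.Ico ((m + 1) ^ 2) ((m + 2) ^ 2)).card : ℕ) : ℝ) *
      ∑ l ∈ Finset.Ico ((m + 1) ^ 2) ((m + 2) ^ 2),
          (walkSum a k (l + 1) ω - walkSum a k l ω) ^ 2) P := fun m =>
    (integrable_finsetSum _ fun l _ => H.integrable_increment_sq k l).const_mul _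
  have hint2 : ∀ m, Integrable (fun ω => (∑ l ∈ Finset.Ico ((m + 1) ^ 2) ((m + 2) ^ 2),
      |walkSum a k (l + 1) ω - walkSum a k l ω|) ^ 2) P := fun m => by
    refine (hint m).mono' ?_ (ae_of_all _ fun ω => ?_)
    · refine Measurable.aestronglyMeasurable ?_
      refine (Finset.measurable_fun_sum _ fun l _ => ?_).pow_const 2
      exact ((H.measurable_walkSum k _).sub (H.measurable_walkSum k _)).norm
    · rw [Real.norm_of_nonneg (sq_nonneg _)]
      exact hsq m ω
  refine ae_tendsto_zero_of_summable_sq _ (fun m => ?_) _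
    (summable_const_div_sq (9 * 4 ^ k * C)) fun m => ?_
  · simp only [div_pow]
    exact (hint2 m).div_const _
  · simp only [div_pow]
    rw [integral_div, div_le_div_iff₀ (by positivity) (by positivity)]
    have hcard : (((Finset.Ico ((m + 1) ^ 2) ((m + 2) ^ 2)).card : ℕ) : ℝ) ≤ 3 * ((m : ℝ) + 1) := by
      have : (Finset.Ico ((m + 1) ^ 2) ((m + 2) ^ 2)).card ≤ 3 * (m + 1) := by
        rw [Nat.card_Ico, Nat.sub_le_iff_le_add]
        nlinarith
      exact_mod_cast this
    have hterm : ∀ l ∈ Finset.Ico ((m + 1) ^ 2) ((m + 2) ^ 2),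
        ∫ ω, (walkSum a k (l + 1) ω - walkSum a k l ω) ^ 2 ∂P ≤
          C * (4 * ((m : ℝ) + 1) ^ 2) ^ k := by
      intro l hl
      refine (hC l).trans ?_
      gcongr
      have hl2 : l + 1 ≤ (m + 2) ^ 2 := (Finset.mem_Ico.1 hl).2
      have hl3 : ((l : ℝ) + 1) ≤ ((m : ℝ) + 2) ^ 2 := by exact_mod_cast hl2
      have hm0 : (0 : ℝ) ≤ m := Nat.cast_nonneg m
      nlinarith
    have hI : ∫ ω, (∑ l ∈ Finset.Ico ((m + 1) ^ 2) ((m + 2) ^ 2),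
        |walkSum a k (l + 1) ω - walkSum a k l ω|) ^ 2 ∂P ≤
        (3 * ((m : ℝ) + 1)) * ((3 * ((m : ℝ) + 1)) * (C * (4 * ((m : ℝ) + 1) ^ 2) ^ k)) := by
      refine (integral_mono (hint2 m) (hint m) (hsq m)).trans ?_
      rw [integral_const_mul, integral_finsetSum _ fun l _ => H.integrable_increment_sq k l]
      refine mul_le_mul hcard ?_
        (Finset.sum_nonneg fun l _ => integral_nonneg fun ω => sq_nonneg _) (by positivity)
      refine (Finset.sum_le_card_nsmul _ _ _ hterm).trans ?_
      rw [nsmul_eq_mul]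
      gcongr
    calc _ ≤ (3 * ((m : ℝ) + 1)) * ((3 * ((m : ℝ) + 1)) * (C * (4 * ((m : ℝ) + 1) ^ 2) ^ k)) *
          ((m : ℝ) + 1) ^ 2 := by gcongr
      _ = _ := by rw [mul_pow, ← pow_mul, ← pow_mul]; ring

theorem ae_tendsto_empiricalMoment (H : IndependentDiagonals P a Cov) (k : ℕ) :
    ∀ᵐ ω ∂P, Tendsto (fun n => empiricalMoment a k n ω) atTop (𝓝 (semicircleMoment k)) := by
  filter_upwards [H.ae_tendsto_deviation k, H.ae_tendsto_oscillation k] with ω hdev hosc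
  have hsub : Tendsto (fun m : ℕ => (m + 1) ^ 2) atTop atTop :=
    tendsto_atTop_mono (fun m => (show m ≤ (m + 1) ^ 2 by nlinarith)) tendsto_id
  have hmean := (H.tendsto_mean_walkSum k).comp hsub
  have hsq : Tendsto (fun m : ℕ => walkSum a k ((m + 1) ^ 2) ω / ((m : ℝ) + 1) ^ (k + 2)) atTop
      (𝓝 (semicircleMoment k)) := by
    have := hdev.add hmean
    rw [zero_add] at this
    refine this.congr fun m => ?_
    have : √(((m + 1) ^ 2 : ℕ) : ℝ) = (m : ℝ) + 1 := by
      push_cast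
      exact Real.sqrt_sq (by positivity)
    simp only [Function.comp_apply, this]
    ring
  have hs : Tendsto (fun n => Nat.sqrt n - 1) atTop atTop := by
    refine tendsto_atTop.2 fun b => ?_
    filter_upwards [eventually_ge_atTop ((b + 1) ^ 2)] with n hn
    have := Nat.le_sqrt'.2 hn
    omega
  have hmain : Tendsto (fun n : ℕ => walkSum a k n ω / (Nat.sqrt n : ℝ) ^ (k + 2)) atTop
      (𝓝 (semicircleMoment k)) := by
    have hdiff : Tendsto (fun n : ℕ => walkSum a k n ω / (Nat.sqrt n : ℝ) ^ (k + 2) -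
        walkSum a k ((Nat.sqrt n - 1 + 1) ^ 2) ω / (((Nat.sqrt n - 1 : ℕ) : ℝ) + 1) ^ (k + 2))
        atTop (𝓝 0) := by
      refine squeeze_zero_norm' ?_ (hosc.comp hs)
      filter_upwards [eventually_ge_atTop 1] with n hn
      have hpos : 0 < Nat.sqrt n := Nat.sqrt_pos.2 hn
      have hcast : (((Nat.sqrt n - 1 : ℕ) : ℝ) + 1) = Nat.sqrt n := by
        rw [Nat.cast_sub hpos]
        simp
      have hnat : Nat.sqrt n - 1 + 1 = Nat.sqrt n := Nat.sub_add_cancel hpos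
      have hnat2 : Nat.sqrt n - 1 + 2 = Nat.sqrt n + 1 := by omega
      have hpos' : (0 : ℝ) < (Nat.sqrt n : ℝ) ^ (k + 2) := by positivity
      simp only [Function.comp_apply]
      rw [hcast, hnat, hnat2, ← sub_div, Real.norm_eq_abs, abs_div, abs_of_pos hpos']
      gcongr
      rw [← Finset.sum_Ico_sub (fun l => walkSum a k l ω) (Nat.sqrt_le' n)]
      refine (Finset.abs_sum_le_sum_abs _ _).trans ?_
      refine Finset.sum_le_sum_of_subset_of_nonneg ?_ fun _ _ _ => abs_nonneg _
      exact Finset.Ico_subset_Ico le_rfl (Nat.lt_succ_sqrt' n).le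
    have := hdiff.add (hsq.comp hs)
    rw [zero_add] at this
    refine this.congr fun n => ?_
    simp
  have hfin := hmain.mul (tendsto_natSqrt_div_sqrt.pow (k + 2))
  rw [one_pow, mul_one] at hfin
  refine hfin.congr' ?_
  filter_upwards [eventually_ge_atTop 1] with n hn
  have hpos : (Nat.sqrt n : ℝ) ≠ 0 := by
    have := Nat.sqrt_pos.2 hn
    positivity
  rw [empiricalMoment, div_pow]
  field_simp

end IndependentDiagonals

/-! ### The moments of the semicircle distribution -/

theorem semicircleDensity_nonneg (x : ℝ) : 0 ≤ semicircleDensity x := by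
  rw [semicircleDensity_eq]
  positivity

theorem continuous_semicircleDensity : Continuous semicircleDensity := by
  rw [funext semicircleDensity_eq]
  fun_prop

theorem semicircleDensity_eq_zero {x : ℝ} (hx : x ∉ Set.Ioc (-2 : ℝ) 2) :
    semicircleDensity x = 0 := by
  rw [semicircleDensity_eq, Real.sqrt_eq_zero_of_nonpos, mul_zero]
  by_contra h
  exact hx ⟨by nlinarith, by nlinarith⟩

theorem integral_semicircle (f : ℝ → ℝ) :
    ∫ x, f x ∂(semicircle : Measure ℝ) = ∫ x in (-2 : ℝ)..2, semicircleDensity x * f x := by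
  change ∫ x, f x ∂((volume : Measure ℝ).withDensity fun x =>
    ENNReal.ofReal (semicircleDensity x)) = _
  rw [integral_withDensity_eq_integral_toReal_smul
    (continuous_semicircleDensity.measurable.ennreal_ofReal)
    (ae_of_all _ fun x => ENNReal.ofReal_lt_top), intervalIntegral.integral_of_le (by norm_num),
    setIntegral_eq_integral_of_forall_compl_eq_zero
      (fun x hx => by rw [semicircleDensity_eq_zero hx, zero_mul])]
  simp only [ENNReal.toReal_ofReal (semicircleDensity_nonneg _), smul_eq_mul]

theorem ae_semicircle_mem_Icc : ∀ᵐ x ∂(semicircle : Measure ℝ), x ∈ Set.Icc (-2 : ℝ) 2 := by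
  change ∀ᵐ x ∂((volume : Measure ℝ).withDensity fun x =>
    ENNReal.ofReal (semicircleDensity x)), x ∈ Set.Icc (-2 : ℝ) 2
  rw [ae_withDensity_iff continuous_semicircleDensity.measurable.ennreal_ofReal]
  refine ae_of_all _ fun x hx => ?_
  by_contra h
  rw [semicircleDensity_eq_zero fun h' => h (Set.Ioc_subset_Icc_self h')] at hx
  simp at hx

theorem hasDerivAt_mul_sqrt {x : ℝ} (hx : x ∈ Set.Ioo (-2 : ℝ) 2) :
    HasDerivAt (fun x : ℝ => (4 - x ^ 2) * √(4 - x ^ 2)) (-3 * x * √(4 - x ^ 2)) x := by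
  have hpos : 0 < 4 - x ^ 2 := by nlinarith [hx.1, hx.2]
  have h1 : HasDerivAt (fun x : ℝ => 4 - x ^ 2) (-(2 * x)) x := by
    simpa using ((hasDerivAt_id x).pow 2).const_sub 4
  have h2 := h1.mul (h1.sqrt hpos.ne')
  refine h2.congr_deriv ?_
  have hs : √(4 - x ^ 2) ≠ 0 := (Real.sqrt_pos.2 hpos).ne'
  field_simp
  rw [Real.sq_sqrt hpos.le]
  ring

theorem integral_id_mul_sqrt : ∫ x in (-2 : ℝ)..2, x * √(4 - x ^ 2) = 0 := by
  have h := intervalIntegral.integral_eq_sub_of_hasDerivAt_of_le (a := -2) (b := 2) (by norm_num)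
    (f := fun x : ℝ => (4 - x ^ 2) * √(4 - x ^ 2)) (f' := fun x => -3 * x * √(4 - x ^ 2))
    (by fun_prop) (fun x hx => hasDerivAt_mul_sqrt hx)
    (Continuous.intervalIntegrable (by fun_prop) _ _)
  simp only [mul_assoc, intervalIntegral.integral_const_mul] at h
  norm_num at h
  exact h

theorem integral_pow_mul_sqrt_succ (k : ℕ) :
    ((k : ℝ) + 4) * ∫ x in (-2 : ℝ)..2, x ^ (k + 2) * √(4 - x ^ 2) =
      4 * (k + 1) * ∫ x in (-2 : ℝ)..2, x ^ k * √(4 - x ^ 2) := by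
  have h := intervalIntegral.integral_eq_sub_of_hasDerivAt_of_le (a := -2) (b := 2) (by norm_num)
    (f := fun x : ℝ => x ^ (k + 1) * ((4 - x ^ 2) * √(4 - x ^ 2)))
    (f' := fun x => 4 * (k + 1) * (x ^ k * √(4 - x ^ 2)) -
      ((k : ℝ) + 4) * (x ^ (k + 2) * √(4 - x ^ 2)))
    (by fun_prop)
    (fun x hx => by
      refine ((hasDerivAt_pow (k + 1) x).mul (hasDerivAt_mul_sqrt hx)).congr_deriv ?_
      simp only [Nat.add_sub_cancel]
      push_cast
      ring)
    (Continuous.intervalIntegrable (by fun_prop) _ _)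
  rw [intervalIntegral.integral_sub (Continuous.intervalIntegrable (by fun_prop) _ _)
    (Continuous.intervalIntegrable (by fun_prop) _ _), intervalIntegral.integral_const_mul,
    intervalIntegral.integral_const_mul] at h
  norm_num at h
  linarith

theorem add_two_mul_catalan_succ (j : ℕ) :
    (j + 2) * catalan (j + 1) = 2 * (2 * j + 1) * catalan j := by
  have h1 := succ_mul_catalan_eq_centralBinom (j + 1)
  have h2 := succ_mul_catalan_eq_centralBinom j
  have h3 := Nat.succ_mul_centralBinom_succ j
  rw [← h1, ← h2] at h3
  have h4 : (j + 1) * ((j + 2) * catalan (j + 1)) = (j + 1) * (2 * (2 * j + 1) * catalan j) := by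
    linarith
  exact Nat.eq_of_mul_eq_mul_left (Nat.succ_pos j) h4

theorem integral_pow_semicircle (k : ℕ) :
    ∫ x, x ^ k ∂(semicircle : Measure ℝ) = semicircleMoment k := by
  have hJ : ∀ k : ℕ, ∫ x, x ^ k ∂(semicircle : Measure ℝ) =
      1 / (2 * Real.pi) * ∫ x in (-2 : ℝ)..2, x ^ k * √(4 - x ^ 2) := fun k => by
    rw [integral_semicircle, ← intervalIntegral.integral_const_mul]
    congr 1
    funext x
    rw [semicircleDensity_eq]
    ring
  induction k using Nat.twoStepInduction with
  | zero => simp [semicircleMoment]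
  | one =>
    rw [hJ, semicircleMoment_odd odd_one]
    simp only [pow_one, integral_id_mul_sqrt, mul_zero]
  | more k ih _ =>
    have hrec : ((k : ℝ) + 4) * ∫ x, x ^ (k + 2) ∂(semicircle : Measure ℝ) =
        4 * (k + 1) * semicircleMoment k := by
      rw [← ih, hJ, hJ]
      linear_combination (1 / (2 * Real.pi)) * integral_pow_mul_sqrt_succ k
    have hk : (k : ℝ) + 4 ≠ 0 := by positivity
    apply mul_left_cancel₀ hk
    rw [hrec]
    rcases Nat.even_or_odd' k with ⟨j, rfl | rfl⟩
    · rw [show 2 * j + 2 = 2 * (j + 1) by ring, semicircleMoment_even, semicircleMoment_even]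
      have := add_two_mul_catalan_succ j
      have h : ((j : ℝ) + 2) * catalan (j + 1) = 2 * (2 * j + 1) * catalan j := by
        exact_mod_cast this
      push_cast
      linear_combination (-2) * h
    · rw [semicircleMoment_odd ⟨j, rfl⟩, semicircleMoment_odd ⟨j + 1, by ring⟩]
      ring

/-! ### Convergence of moments implies weak convergence -/

theorem Polynomial.exists_abs_eval_le (p : Polynomial ℝ) :
    ∃ K : ℝ, 0 ≤ K ∧ ∀ x : ℝ, 1 ≤ |x| → |p.eval x| ≤ K * x ^ (2 * p.natDegree) := by
  refine ⟨∑ i ∈ Finset.range (p.natDegree + 1), |p.coeff i|,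
    Finset.sum_nonneg fun _ _ => abs_nonneg _, fun x hx => ?_⟩
  rw [Polynomial.eval_eq_sum_range, Finset.sum_mul]
  refine (Finset.abs_sum_le_sum_abs _ _).trans (Finset.sum_le_sum fun i hi => ?_)
  rw [abs_mul, abs_pow, pow_mul, ← sq_abs, ← pow_mul]
  have := Finset.mem_range.1 hi
  exact mul_le_mul_of_nonneg_left (pow_le_pow_right₀ hx (by omega)) (abs_nonneg _)

theorem tendsto_integral_of_tendsto_moments (ν : ℕ → Measure ℝ) (μ : Measure ℝ)
    [∀ n, IsProbabilityMeasure (ν n)] [IsProbabilityMeasure μ]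
    (hν : ∀ n k, Integrable (fun x : ℝ => x ^ k) (ν n))
    (hμ : ∀ᵐ x ∂μ, x ∈ Set.Icc (-2 : ℝ) 2)
    (h : ∀ k : ℕ, Tendsto (fun n => ∫ x, x ^ k ∂(ν n)) atTop (𝓝 (∫ x, x ^ k ∂μ)))
    (f : BoundedContinuousFunction ℝ ℝ) :
    Tendsto (fun n => ∫ x, f x ∂(ν n)) atTop (𝓝 (∫ x, f x ∂μ)) := by
  have hμpow : ∀ k : ℕ, Integrable (fun x : ℝ => x ^ k) μ := fun k => by
    refine Integrable.mono' (integrable_const ((2 : ℝ) ^ k)) (by fun_prop) ?_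
    filter_upwards [hμ] with x hx
    rw [Real.norm_eq_abs, abs_pow]
    exact pow_le_pow_left₀ (abs_nonneg _) (abs_le.2 ⟨hx.1, hx.2⟩) _
  have hpolyInt : ∀ (ρ : Measure ℝ), (∀ k, Integrable (fun x : ℝ => x ^ k) ρ) →
      ∀ p : Polynomial ℝ, Integrable (fun x => p.eval x) ρ := fun ρ hρ p => by
    simp only [Polynomial.eval_eq_sum_range]
    exact integrable_finsetSum _ fun i _ => (hρ i).const_mul _
  have hpolyEq : ∀ (ρ : Measure ℝ), (∀ k, Integrable (fun x : ℝ => x ^ k) ρ) →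
      ∀ p : Polynomial ℝ, ∫ x, p.eval x ∂ρ =
        ∑ i ∈ Finset.range (p.natDegree + 1), p.coeff i * ∫ x, x ^ i ∂ρ := fun ρ hρ p => by
    simp only [Polynomial.eval_eq_sum_range]
    rw [integral_finsetSum _ fun i _ => (hρ i).const_mul _]
    simp only [integral_const_mul]
  have hpoly : ∀ p : Polynomial ℝ,
      Tendsto (fun n => ∫ x, p.eval x ∂(ν n)) atTop (𝓝 (∫ x, p.eval x ∂μ)) := fun p => by
    simp only [hpolyEq _ (hν _) p, hpolyEq _ hμpow p]
    exact tendsto_finsetSum _ fun i _ => (h i).const_mul _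
  rw [Metric.tendsto_atTop]
  intro ε hε
  obtain ⟨p, hp⟩ := exists_polynomial_near_of_continuousOn (-3) 3 f f.continuous.continuousOn
    (ε / 5) (by positivity)
  obtain ⟨K₀, hK₀, hpK⟩ := p.exists_abs_eval_le
  set d := p.natDegree with hd
  set K := ‖f‖ + K₀ with hK
  have hK0 : 0 ≤ K := by positivity
  have htail : ∀ x : ℝ, 3 ≤ |x| → |p.eval x - f x| ≤ K * x ^ (2 * d) := by
    intro x hx
    have h1 : 1 ≤ x ^ (2 * d) := by
      rw [pow_mul, ← sq_abs, ← pow_mul]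
      exact one_le_pow₀ (by linarith)
    have h2 : |f x| ≤ ‖f‖ := f.norm_coe_le_norm x
    have h3 := hpK x (by linarith)
    have h4 : ‖f‖ ≤ ‖f‖ * x ^ (2 * d) := le_mul_of_one_le_right (norm_nonneg f) h1
    calc |p.eval x - f x| ≤ |p.eval x| + |f x| := abs_sub _ _
      _ ≤ K * x ^ (2 * d) := by rw [hK, add_mul]; linarith
  have hall : ∀ (m : ℕ) (x : ℝ),
      ‖p.eval x - f x‖ ≤ ε / 5 + K / 9 ^ m * x ^ (2 * (d + m)) := by
    intro m x
    rw [Real.norm_eq_abs]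
    have hnn : 0 ≤ x ^ (2 * (d + m)) := by rw [pow_mul]; positivity
    rcases le_total |x| 3 with hx | hx
    · have h1 := (hp x (abs_le.1 hx)).le
      have : 0 ≤ K / 9 ^ m * x ^ (2 * (d + m)) := by positivity
      linarith
    · have h1 := htail x hx
      have h2 : (9 : ℝ) ^ m ≤ x ^ (2 * m) := by
        rw [pow_mul, ← sq_abs]
        exact pow_le_pow_left₀ (by norm_num) (by nlinarith) _
      have h3 : 0 ≤ x ^ (2 * d) := by rw [pow_mul]; positivity
      have h4 : K * x ^ (2 * d) ≤ K / 9 ^ m * x ^ (2 * (d + m)) := by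
        rw [div_mul_eq_mul_div, le_div_iff₀ (by positivity), mul_add, pow_add, ← mul_assoc]
        exact mul_le_mul_of_nonneg_left h2 (by positivity)
      linarith
  have hclose : ∀ (ρ : Measure ℝ) [IsProbabilityMeasure ρ],
      (∀ k, Integrable (fun x : ℝ => x ^ k) ρ) → ∀ m : ℕ,
      |(∫ x, p.eval x ∂ρ) - ∫ x, f x ∂ρ| ≤ ε / 5 + K / 9 ^ m * ∫ x, x ^ (2 * (d + m)) ∂ρ := by
    intro ρ _ hρ m
    rw [← integral_sub (hpolyInt ρ hρ p) (f.integrable ρ), ← Real.norm_eq_abs]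
    refine (norm_integral_le_of_norm_le ((integrable_const _).add ((hρ _).const_mul _))
      (ae_of_all _ (hall m))).trans_eq ?_
    rw [integral_add' (integrable_const _) ((hρ _).const_mul _), integral_const_mul]
    simp
  have hμmom : ∀ m, ∫ x, x ^ (2 * (d + m)) ∂μ ≤ 4 ^ (d + m) := fun m => by
    have : ∫ x, x ^ (2 * (d + m)) ∂μ ≤ ∫ _x, (4 : ℝ) ^ (d + m) ∂μ := by
      refine integral_mono_ae (hμpow _) (integrable_const _) ?_
      filter_upwards [hμ] with x hx
      rw [pow_mul]
      exact pow_le_pow_left₀ (sq_nonneg x) (by nlinarith [hx.1, hx.2]) _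
    simpa using this
  obtain ⟨m, hm⟩ : ∃ m : ℕ, K / 9 ^ m * (4 ^ (d + m) + 1) < ε / 5 := by
    have hlim : Tendsto (fun m : ℕ => K * 4 ^ d * (4 / 9 : ℝ) ^ m + K * (1 / 9 : ℝ) ^ m) atTop
        (𝓝 (K * 4 ^ d * 0 + K * 0)) :=
      ((tendsto_pow_atTop_nhds_zero_of_lt_one (by norm_num) (by norm_num)).const_mul _).add
        ((tendsto_pow_atTop_nhds_zero_of_lt_one (by norm_num) (by norm_num)).const_mul _)
    simp only [mul_zero, add_zero] at hlim
    obtain ⟨m, hm⟩ := (hlim.eventually (gt_mem_nhds (by positivity : (0 : ℝ) < ε / 5))).exists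
    refine ⟨m, lt_of_eq_of_lt ?_ hm⟩
    rw [div_pow, div_pow, one_pow, pow_add]
    ring
  have hcoef : 0 ≤ K / 9 ^ m := by positivity
  have hμc := hclose μ hμpow m
  have hev1 := (h (2 * (d + m))).eventually (gt_mem_nhds
    (lt_of_le_of_lt (hμmom m) (lt_add_one ((4 : ℝ) ^ (d + m)))))
  have hev2 := (Metric.tendsto_atTop.1 (hpoly p)) (ε / 5) (by positivity)
  obtain ⟨N₁, hN₁⟩ := eventually_atTop.1 hev1
  obtain ⟨N₂, hN₂⟩ := hev2
  refine ⟨max N₁ N₂, fun n hn => ?_⟩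
  have h1 := hN₁ n ((le_max_left _ _).trans hn)
  have h2 := hN₂ n ((le_max_right _ _).trans hn)
  have h3 := hclose (ν n) (hν n) m
  have h4 : K / 9 ^ m * ∫ x, x ^ (2 * (d + m)) ∂(ν n) < ε / 5 :=
    (mul_le_mul_of_nonneg_left h1.le hcoef).trans_lt hm
  have h5 : K / 9 ^ m * ∫ x, x ^ (2 * (d + m)) ∂μ < ε / 5 :=
    (mul_le_mul_of_nonneg_left ((hμmom m).trans (le_add_of_nonneg_right zero_le_one))
      hcoef).trans_lt hm
  rw [Real.dist_eq] at h2 ⊢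
  rw [abs_lt] at h2 ⊢
  rw [abs_le] at h3 hμc
  constructor <;> linarith

/-! ### The empirical eigenvalue distribution -/

theorem Matrix.pow_apply_eq_sum_walks {n : ℕ} (A : Matrix (Fin n) (Fin n) ℝ) (k : ℕ)
    (i j : Fin n) : (A ^ k) i j = ∑ p : Fin (k + 1) → Fin n,
      if p 0 = i ∧ p (Fin.last k) = j then ∏ e : Fin k, A (p e.castSucc) (p e.succ) else 0 := by
  induction k generalizing i with
  | zero =>
    rw [pow_zero, Matrix.one_apply,
      ← (Equiv.funUnique (Fin 1) (Fin n)).symm.sum_comp]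
    simp only [Equiv.funUnique_symm_apply, uniqueElim_const, Finset.univ_eq_empty,
      Finset.prod_empty]
    by_cases h : i = j
    · subst h
      simp
    · rw [if_neg h, Finset.sum_eq_zero]
      intro x _
      rw [if_neg]
      rintro ⟨rfl, rfl⟩
      exact h rfl
  | succ k ih =>
    rw [pow_succ', Matrix.mul_apply, ← (Fin.consEquiv fun _ => Fin n).sum_comp,
      Fintype.sum_prod_type]
    simp only [ih, Finset.mul_sum]
    rw [Finset.sum_comm, Finset.sum_comm (s := (Finset.univ : Finset (Fin n)))]
    refine Finset.sum_congr rfl fun q _ => ?_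
    rw [Finset.sum_eq_single (q 0) (fun l _ hl => by rw [if_neg fun h => hl h.1.symm, mul_zero])
      (fun h => absurd (Finset.mem_univ _) h),
      Finset.sum_eq_single i (fun l _ hl => by
        rw [if_neg]
        rintro ⟨h, -⟩
        exact hl h)
      (fun h => absurd (Finset.mem_univ _) h)]
    have hlast : (Fin.consEquiv fun _ => Fin n) (i, q) (Fin.last (k + 1)) = q (Fin.last k) := rfl
    have hzero : (Fin.consEquiv fun _ => Fin n) (i, q) 0 = i := rfl
    rw [hlast, hzero, Fin.prod_univ_succ]
    by_cases hq : q (Fin.last k) = j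
    · rw [if_pos ⟨rfl, hq⟩, if_pos ⟨rfl, hq⟩]
      rfl
    · rw [if_neg fun h => hq h.2, if_neg fun h => hq h.2, mul_zero]

theorem trace_pow_eq_sum_closedWalks {n : ℕ} (A : Matrix (Fin n) (Fin n) ℝ) (f : ℕ → ℕ → ℝ)
    (hA : ∀ i j, A i j = f i j) (k : ℕ) :
    (A ^ k).trace = ∑ p ∈ closedWalks k n, ∏ e : Fin k, f (p e.castSucc) (p e.succ) := by
  simp only [Matrix.trace, Matrix.diag_apply, Matrix.pow_apply_eq_sum_walks]
  rw [Finset.sum_comm]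
  have h1 : ∀ p : Fin (k + 1) → Fin n, (∑ i, if p 0 = i ∧ p (Fin.last k) = i then
      ∏ e : Fin k, A (p e.castSucc) (p e.succ) else 0) =
      if p 0 = p (Fin.last k) then ∏ e : Fin k, A (p e.castSucc) (p e.succ) else 0 := fun p => by
    rw [Finset.sum_eq_single (p 0) (fun i _ hi => if_neg fun h => hi h.1.symm)
      (fun h => absurd (Finset.mem_univ _) h)]
    simp only [true_and, eq_comm]
  simp only [h1]
  rw [← Finset.sum_filter]
  refine Finset.sum_bij (fun p _ v => (p v : ℕ)) ?_ ?_ ?_ ?_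
  · intro p hp
    rw [Finset.mem_filter] at hp
    exact mem_closedWalks.2 ⟨fun v => (p v).2, congrArg Fin.val hp.2⟩
  · intro p _ q _ h
    funext v
    exact Fin.ext (congrFun h v)
  · intro p hp
    rw [mem_closedWalks] at hp
    refine ⟨fun v => ⟨p v, hp.1 v⟩, ?_, rfl⟩
    rw [Finset.mem_filter]
    exact ⟨Finset.mem_univ _, Fin.ext hp.2⟩
  · intro p _
    exact Finset.prod_congr rfl fun e _ => hA _ _

theorem Matrix.IsHermitian.sum_eigenvalues_pow {n : ℕ} {A : Matrix (Fin n) (Fin n) ℝ}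
    (hA : A.IsHermitian) (k : ℕ) : ∑ i, hA.eigenvalues i ^ k = (A ^ k).trace := by
  conv_rhs => rw [hA.spectral_theorem]
  rw [← map_pow, Unitary.conjStarAlgAut_apply, Matrix.trace_mul_comm, ← mul_assoc,
    Unitary.coe_star_mul_self, one_mul, Matrix.diagonal_pow, Matrix.trace_diagonal]
  simp

section

variable {Ω : Type*} (a : ℕ → ℕ → Ω → ℝ) (n : ℕ)

theorem randomMatrix_apply (ω : Ω) (i j : Fin n) :
    randomMatrix a n ω i j = entry a i j ω / √(n : ℝ) := by
  simp only [randomMatrix, Matrix.of_apply, entry]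
  split_ifs with h
  · rw [min_eq_left h, max_eq_right h]
  · rw [min_eq_right (not_le.1 h).le, max_eq_left (not_le.1 h).le]

theorem sum_eigenvalues_pow_eq (k : ℕ) (ω : Ω) :
    ∑ i, (randomMatrix_isHermitian a n ω).eigenvalues i ^ k =
      walkSum a k n ω / √(n : ℝ) ^ k := by
  rw [Matrix.IsHermitian.sum_eigenvalues_pow,
    trace_pow_eq_sum_closedWalks _ (fun i j => entry a i j ω / √(n : ℝ))
      (randomMatrix_apply a n ω), walkSum, Finset.sum_div]
  refine Finset.sum_congr rfl fun p _ => ?_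
  rw [walkWeight, Finset.prod_div_distrib]
  simp

theorem integral_empiricalDistribution (ω : Ω) (f : ℝ → ℝ) :
    ∫ x, f x ∂(empiricalDistribution a n ω) =
      (n : ℝ)⁻¹ * ∑ i, f ((randomMatrix_isHermitian a n ω).eigenvalues i) := by
  rw [empiricalDistribution, integral_smul_measure,
    integral_finsetSum_measure fun i _ => integrable_dirac (by simp)]
  simp

theorem integrable_empiricalDistribution (hn : 1 ≤ n) (ω : Ω) (f : ℝ → ℝ) :
    Integrable f (empiricalDistribution a n ω) := by
  rw [empiricalDistribution]
  refine Integrable.smul_measure ?_ (by simp; omega)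
  exact integrable_finsetSum_measure.2 fun i _ => integrable_dirac (by simp)

theorem integral_pow_empiricalDistribution (ω : Ω) (k : ℕ) :
    ∫ x, x ^ k ∂(empiricalDistribution a n ω) = empiricalMoment a k n ω := by
  rw [integral_empiricalDistribution, sum_eigenvalues_pow_eq, empiricalMoment, pow_add,
    Real.sq_sqrt (by positivity), inv_mul_eq_div, div_div]

theorem isProbabilityMeasure_empiricalDistribution (hn : 1 ≤ n) (ω : Ω) :
    IsProbabilityMeasure (empiricalDistribution a n ω) := by
  constructor
  rw [empiricalDistribution, Measure.smul_apply, Measure.finsetSum_apply]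
  simp only [measure_univ, Finset.sum_const, Finset.card_univ, Fintype.card_fin, nsmul_eq_mul,
    mul_one, smul_eq_mul]
  exact ENNReal.inv_mul_cancel (by simp; omega) (by simp)

variable {a} [MeasurableSpace Ω]

/-- Continuous linear statistics of the eigenvalues are measurable. -/
theorem measurable_sum_eigenvalues (ha : ∀ k, Measurable (walkSum a k n)) (f : ℝ → ℝ)
    (hf : Continuous f) :
    Measurable fun ω => ∑ i, f ((randomMatrix_isHermitian a n ω).eigenvalues i) := by
  have happrox : ∀ N : ℕ, ∃ p : Polynomial ℝ, ∀ x ∈ Set.Icc (-(N : ℝ)) N,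
      |p.eval x - f x| < 1 / ((N : ℝ) + 1) := fun N =>
    exists_polynomial_near_of_continuousOn _ _ f hf.continuousOn _ (by positivity)
  choose p hp using happrox
  refine measurable_of_tendsto_metrizable (f := fun N ω =>
    ∑ i, (p N).eval ((randomMatrix_isHermitian a n ω).eigenvalues i)) (fun N => ?_) ?_
  · simp only [Polynomial.eval_eq_sum_range]
    simp only [Finset.sum_comm (s := (Finset.univ : Finset (Fin n))), ← Finset.mul_sum,
      sum_eigenvalues_pow_eq]
    exact Finset.measurable_fun_sum _ fun k _ => ((ha k).div_const _).const_mul _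
  · rw [tendsto_pi_nhds]
    intro ω
    refine tendsto_finsetSum _ fun i _ => ?_
    set x := (randomMatrix_isHermitian a n ω).eigenvalues i
    rw [tendsto_iff_norm_sub_tendsto_zero]
    refine squeeze_zero' (Eventually.of_forall fun _ => norm_nonneg _) ?_
      tendsto_one_div_add_atTop_nhds_zero_nat
    filter_upwards [eventually_ge_atTop ⌈|x|⌉₊] with N hN
    exact (hp N x (abs_le.1 (Nat.ceil_le.1 hN))).le

theorem measurable_empiricalDistribution (hn : 1 ≤ n) (ha : ∀ k, Measurable (walkSum a k n)) :
    Measurable (empiricalDistribution a n) := by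
  have := isProbabilityMeasure_empiricalDistribution a n hn
  refine Measurable.measure_of_isPiSystem_of_isProbabilityMeasure
    (BorelSpace.measurable_eq.trans (borel_eq_generateFrom_Iic ℝ)) isPiSystem_Iic ?_
  rintro _ ⟨t, rfl⟩
  let g : ℕ → ℝ → ℝ := fun j x => max 0 (min 1 (1 - j * (x - t)))
  have hg : ∀ x, Tendsto (fun j => g j x) atTop (𝓝 ((Set.Iic t).indicator 1 x)) := by
    intro x
    by_cases hx : x ≤ t
    · rw [Set.indicator_of_mem (Set.mem_Iic.2 hx)]
      refine tendsto_const_nhds.congr fun j => ?_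
      have : (j : ℝ) * (x - t) ≤ 0 :=
        mul_nonpos_of_nonneg_of_nonpos (Nat.cast_nonneg j) (by linarith)
      simp only [g, Pi.one_apply]
      rw [min_eq_left (by linarith), max_eq_right zero_le_one]
    · rw [Set.indicator_of_notMem (by simpa using hx)]
      have hpos : 0 < x - t := by linarith [not_le.1 hx]
      refine tendsto_const_nhds.congr' ?_
      filter_upwards [eventually_ge_atTop ⌈1 / (x - t)⌉₊] with j hj
      have h1 : 1 / (x - t) ≤ j := Nat.ceil_le.1 hj
      rw [div_le_iff₀ hpos] at h1
      simp only [g]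
      rw [max_eq_left ((min_le_right _ _).trans (by linarith))]
  have hm : Measurable fun ω => ∑ i, (Set.Iic t).indicator (1 : ℝ → ℝ)
      ((randomMatrix_isHermitian a n ω).eigenvalues i) := by
    refine measurable_of_tendsto_metrizable (f := fun j ω =>
      ∑ i, g j ((randomMatrix_isHermitian a n ω).eigenvalues i))
      (fun j => measurable_sum_eigenvalues n ha _ (by fun_prop)) ?_
    rw [tendsto_pi_nhds]
    exact fun ω => tendsto_finsetSum _ fun i _ => hg _
  have heq : (fun ω => empiricalDistribution a n ω (Set.Iic t)) = fun ω =>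
      ENNReal.ofReal ((n : ℝ)⁻¹ * ∑ i, (Set.Iic t).indicator (1 : ℝ → ℝ)
        ((randomMatrix_isHermitian a n ω).eigenvalues i)) := by
    funext ω
    rw [← integral_empiricalDistribution, integral_indicator_one measurableSet_Iic,
      ofReal_measureReal]
  rw [heq]
  exact (hm.const_mul _).ennreal_ofReal

end

theorem convergesWeakly_of_lintegral {ν : ℕ → Measure ℝ} {μ : ProbabilityMeasure ℝ}
    (hν : ∀ n, 1 ≤ n → IsProbabilityMeasure (ν n))
    (h : ∀ f : BoundedContinuousFunction ℝ NNReal,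
      Tendsto (fun n => ∫⁻ x, f x ∂(ν n)) atTop (𝓝 (∫⁻ x, f x ∂(μ : Measure ℝ)))) :
    ConvergesWeakly ν μ := by
  let ν' : ℕ → ProbabilityMeasure ℝ := fun n => ⟨ν (n + 1), hν (n + 1) (Nat.le_add_left 1 n)⟩
  have hlim : Tendsto ν' atTop (𝓝 μ) :=
    ProbabilityMeasure.tendsto_iff_forall_lintegral_tendsto.2 fun f =>
      (h f).comp (tendsto_add_atTop_nat 1)
  refine ⟨fun n => ν' (n - 1), fun n hn => ?_, hlim.comp (tendsto_sub_atTop_nat 1)⟩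
  change ν (n - 1 + 1) = _
  rw [Nat.sub_add_cancel hn]

theorem ConvergesWeakly.tendsto_lintegral {ν : ℕ → Measure ℝ} {μ : ProbabilityMeasure ℝ}
    (h : ConvergesWeakly ν μ) (f : BoundedContinuousFunction ℝ NNReal) :
    Tendsto (fun n => ∫⁻ x, f x ∂(ν n)) atTop (𝓝 (∫⁻ x, f x ∂(μ : Measure ℝ))) := by
  obtain ⟨ν', h1, h2⟩ := h
  refine (ProbabilityMeasure.tendsto_iff_forall_lintegral_tendsto.1 h2 f).congr' ?_
  filter_upwards [eventually_ge_atTop 1] with n hn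
  rw [h1 n hn]

theorem convergesWeakly_of_moments {Ω : Type*} (a : ℕ → ℕ → Ω → ℝ) (ω : Ω)
    (h : ∀ k, Tendsto (fun n => empiricalMoment a k n ω) atTop (𝓝 (semicircleMoment k))) :
    ConvergesWeakly (fun n => empiricalDistribution a n ω) semicircle := by
  have hprob : ∀ n, IsProbabilityMeasure (empiricalDistribution a (n + 1) ω) := fun n =>
    isProbabilityMeasure_empiricalDistribution a (n + 1) (by omega) ω
  let ν' : ℕ → ProbabilityMeasure ℝ := fun n => ⟨empiricalDistribution a (n + 1) ω, hprob n⟩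
  have hlim : Tendsto ν' atTop (𝓝 semicircle) := by
    rw [ProbabilityMeasure.tendsto_iff_forall_integral_tendsto]
    refine tendsto_integral_of_tendsto_moments (fun n => empiricalDistribution a (n + 1) ω) _
      (fun n k => integrable_empiricalDistribution a (n + 1) (by omega) ω _)
      ae_semicircle_mem_Icc fun k => ?_
    simp only [integral_pow_empiricalDistribution, integral_pow_semicircle]
    exact (h k).comp (tendsto_add_atTop_nat 1)
  refine ⟨fun n => ν' (n - 1), fun n hn => ?_, hlim.comp (tendsto_sub_atTop_nat 1)⟩
  change empiricalDistribution a (n - 1 + 1) ω = _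
  rw [Nat.sub_add_cancel hn]

theorem convergesWeakly_mean_of_ae {Ω : Type*} [MeasurableSpace Ω] (P : Measure Ω)
    [IsProbabilityMeasure P] (a : ℕ → ℕ → Ω → ℝ) (μ : ProbabilityMeasure ℝ)
    (hmeas : ∀ n, 1 ≤ n → Measurable (empiricalDistribution a n))
    (h : ∀ᵐ ω ∂P, ConvergesWeakly (fun n => empiricalDistribution a n ω) μ) :
    ConvergesWeakly (meanEmpiricalDistribution P a) μ := by
  refine convergesWeakly_of_lintegral (fun n hn => ?_) fun f => ?_
  · exact isProbabilityMeasure_bind (hmeas n hn).aemeasurable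
      (ae_of_all _ fun ω => isProbabilityMeasure_empiricalDistribution a n hn ω)
  · have hfm : Measurable fun x => (f x : ℝ≥0∞) :=
      f.continuous.measurable.coe_nnreal_ennreal
    obtain ⟨C, hC⟩ : ∃ C : NNReal, ∀ x, f x ≤ C := by
      obtain ⟨C, hC⟩ := f.isBounded_range.bddAbove
      exact ⟨C, fun x => hC ⟨x, rfl⟩⟩
    have hlim : Tendsto (fun n => ∫⁻ ω, ∫⁻ x, f x ∂(empiricalDistribution a (n + 1) ω) ∂P) atTop
        (𝓝 (∫⁻ _ω, ∫⁻ x, f x ∂(μ : Measure ℝ) ∂P)) := by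
      refine tendsto_lintegral_of_dominated_convergence (fun _ => (C : ℝ≥0∞)) (fun n => ?_)
        (fun n => ae_of_all _ fun ω => ?_) (by simp) ?_
      · exact (Measure.measurable_lintegral hfm).comp (hmeas (n + 1) (by omega))
      · have := isProbabilityMeasure_empiricalDistribution a (n + 1) (by omega) ω
        refine (lintegral_mono (g := fun _ => (C : ℝ≥0∞)) fun x => ?_).trans_eq (by simp)
        exact ENNReal.coe_le_coe.2 (hC x)
      · filter_upwards [h] with ω hω
        exact (hω.tendsto_lintegral f).comp (tendsto_add_atTop_nat 1)
    rw [← tendsto_add_atTop_iff_nat 1]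
    simp only [lintegral_const, measure_univ, mul_one] at hlim
    refine hlim.congr fun n => ?_
    rw [meanEmpiricalDistribution, Measure.lintegral_bind
      (hmeas (n + 1) (by omega)).aemeasurable hfm.aemeasurable]

theorem theorem1 {Ω : Type*} [MeasurableSpace Ω] (P : Measure Ω) [IsProbabilityMeasure P]
    (a : ℕ → ℕ → Ω → ℝ)
    (hmeas : ∀ p q, p ≤ q → Measurable (a p q))
    -- (C1) centered, unit variance, uniformly bounded absolute moments of every order
    (hmean : ∀ p q, p ≤ q → ∫ ω, a p q ω ∂P = 0)
    (hvar : ∀ p q, p ≤ q → ∫ ω, (a p q ω) ^ 2 ∂P = 1)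
    (hmom : ∀ k : ℕ, (⨆ (p : ℕ) (q : ℕ) (_ : p ≤ q), ∫⁻ ω, ‖a p q ω‖ₑ ^ k ∂P) < ∞)
    -- (C2) the diagonals are independent families
    (hindep : iIndepFun (fun (r : ℕ) (ω : Ω) (p : ℕ) => a p (p + r) ω) P)
    -- (C3) the covariance of two entries on the same diagonal depends only on the lag
    (Cov : ℕ → ℝ)
    (hcov : ∀ τ p q, p ≤ q → cov[a p q, a (p + τ) (q + τ); P] = Cov τ)
    -- (C4) the covariances are absolutely summable
    (hsum : Summable fun τ => |Cov τ|) :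
    ConvergesWeakly (meanEmpiricalDistribution P a) semicircle ∧
      ∀ᵐ ω ∂P, ConvergesWeakly (fun n => empiricalDistribution a n ω) semicircle := by
  have H : IndependentDiagonals P a Cov := ⟨hmeas, hmean, hvar, hmom, hindep, hcov, hsum⟩
  have hae : ∀ᵐ ω ∂P, ConvergesWeakly (fun n => empiricalDistribution a n ω) semicircle := by
    filter_upwards [ae_all_iff.2 H.ae_tendsto_empiricalMoment] with ω hω
    exact convergesWeakly_of_moments a ω hω
  exact ⟨convergesWeakly_mean_of_ae P a _ (fun n hn =>
    measurable_empiricalDistribution n hn fun k => H.measurable_walkSum k n) hae, hae⟩
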